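/- Graphs are finite, simple and undirected. Let $\mathcal H$ be a finite family of graphs, let $r=r(\mathcal H)=\max\{|V(H)| : H\in\mathcal H\}$, and let $t$ be an integer; assume $r\ge 1$ and $t\ge 1$. The family $\mathcal H$ and the number $t$ are fixed. In the problem \emph{$\mathcal H$-Packing with $t$-Membership}, the input is a graph $G$ and an integer $k\ge 0$, the parameter is $k$, and the question is whether $G$ has a set $\mathcal K$ of at least $k$ subgraphs such that each member of $\mathcal K$ is isomorphic to some graph in $\mathcal H$, different members of $\mathcal K$ have different vertex sets, and every vertex of $G$ lies in at most $t$ members of $\mathcal K$. In the induced version the members of $\mathcal K$ have to be induced subgraphs of $G$. In the ISV variant (identical sets of vertices) the condition that different members of $\mathcal K$ have different vertex sets is dropped, so that $\mathcal K$ is any set of distinct subgraphs. A parameterized graph problem has a \emph{kernel with at most $f(k)$ vertices} if there is an algorithm that turns each instance $(G,k)$, in time polynomial in its size ($k$ being written in binary), into an instance $(G',k')$ of the same problem such that $(G',k')$ is a yes-instance if and only if $(G,k)$ is, $|V(G')|\le f(k)$, and $k'\le k$. Theorem. $\mathcal H$-Packing with $t$-Membership, its induced version, and its ISV variant each have a kernel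 with $O((r+1)^r k^r)$ vertices, where the hidden constant depends on $r$ only (neither on $t$ nor otherwise on $\mathcal H$); more precisely, each has a kernel with at most $2\,r!\,(r+1)^r k^r$ vertices. -/

import Mathlib

/-! ### The packing problems -/

/-- A finite family of finite graphs, each given on a vertex set `Fin m`. -/
abbrev GraphFamily : Type := Finset (Σ m : ℕ, SimpleGraph (Fin m))

/-- `r(𝓗)`: the largest number of vertices of a member of the family. -/
def GraphFamily.order (𝓗 : GraphFamily) : ℕ := 𝓗.sup fun H => H.1

/-- The subgraph `A` of `G` is isomorphic to some member of the family. -/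
def IsFamilySubgraph (𝓗 : GraphFamily) {V : Type} {G : SimpleGraph V} (A : G.Subgraph) : Prop :=
  ∃ H ∈ 𝓗, Nonempty (A.coe ≃g H.2)

/-- Every vertex of `G` lies in at most `t` of the subgraphs in `K`. -/
def BoundedMembership (t : ℕ) {V : Type} {G : SimpleGraph V} (K : Finset G.Subgraph) : Prop :=
  ∀ v : V, {A : G.Subgraph | A ∈ K ∧ v ∈ A.verts}.ncard ≤ t

/-- `𝓗`-Packing with `t`-Membership: `G` has a set of at least `k` subgraphs, each isomorphic to a
member of `𝓗`, with pairwise different vertex sets, such that every vertex is in at most `t`. -/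
def HPackingMembership (𝓗 : GraphFamily) (t : ℕ) {V : Type} (G : SimpleGraph V) (k : ℕ) : Prop :=
  ∃ K : Finset G.Subgraph, k ≤ K.card ∧ (∀ A ∈ K, IsFamilySubgraph 𝓗 A) ∧
    (∀ A ∈ K, ∀ B ∈ K, A ≠ B → A.verts ≠ B.verts) ∧ BoundedMembership t K

/-- Induced-`𝓗`-Packing with `t`-Membership: the same with induced subgraphs. -/
def InducedHPackingMembership (𝓗 : GraphFamily) (t : ℕ) {V : Type} (G : SimpleGraph V) (k : ℕ) :
    Prop :=
  ∃ K : Finset G.Subgraph, k ≤ K.card ∧ (∀ A ∈ K, A.IsInduced ∧ IsFamilySubgraph 𝓗 A) ∧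
    (∀ A ∈ K, ∀ B ∈ K, A ≠ B → A.verts ≠ B.verts) ∧ BoundedMembership t K

/-- The ISV ("identical sets of vertices") variant: the subgraphs have to be distinct, but distinct
subgraphs may have the same vertex set. -/
def HPackingMembershipISV (𝓗 : GraphFamily) (t : ℕ) {V : Type} (G : SimpleGraph V) (k : ℕ) : Prop :=
  ∃ K : Finset G.Subgraph, k ≤ K.card ∧ (∀ A ∈ K, IsFamilySubgraph 𝓗 A) ∧ BoundedMembership t K

/-! ### Polynomial time: random access machines with a step count -/

/-- A state of the machine: registers, and a memory that is addressed through registers. -/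
structure RAMState where
  reg : ℕ → ℕ
  mem : ℕ → ℕ

/-- Instructions of the machine. There is no multiplication, so in `T` steps numbers grow by at most
`O(T)` bits, and counting one step per instruction is polynomially equivalent to Turing machine
time. -/
inductive RAMInstr where
  /-- `reg i := c` -/
  | const (i c : ℕ)
  /-- `reg i := reg j` -/
  | move (i j : ℕ)
  /-- `reg i := reg j + reg l` -/
  | add (i j l : ℕ)
  /-- `reg i := reg j - reg l`, and `0` if this is negative -/
  | sub (i j l : ℕ)
  /-- `reg i := mem (reg j)` -/
  | load (i j : ℕ)
  /-- `mem (reg i) := reg j` -/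
  | store (i j : ℕ)

/-- The effect of one instruction. -/
def RAMInstr.apply : RAMInstr → RAMState → RAMState
  | .const i c, s => { s with reg := Function.update s.reg i c }
  | .move i j, s => { s with reg := Function.update s.reg i (s.reg j) }
  | .add i j l, s => { s with reg := Function.update s.reg i (s.reg j + s.reg l) }
  | .sub i j l, s => { s with reg := Function.update s.reg i (s.reg j - s.reg l) }
  | .load i j, s => { s with reg := Function.update s.reg i (s.mem (s.reg j)) }
  | .store i j, s => { s with mem := Function.update s.mem (s.reg i) (s.reg j) }

/-- Programs of the machine. -/
inductive RAMProg where
  | skip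
  | instr (a : RAMInstr)
  | seq (P Q : RAMProg)
  /-- run `P` if `reg i ≠ 0`, and `Q` otherwise -/
  | ite (i : ℕ) (P Q : RAMProg)
  /-- run `P` as long as `reg i ≠ 0` -/
  | while (i : ℕ) (P : RAMProg)

/-- `RAMExec P s T s'`: started in the state `s`, the program `P` halts in the state `s'` after
exactly `T` steps. Each instruction and each test of a register takes one step. -/
inductive RAMExec : RAMProg → RAMState → ℕ → RAMState → Prop where
  | skip (s : RAMState) : RAMExec .skip s 1 s
  | instr (a : RAMInstr) (s : RAMState) : RAMExec (.instr a) s 1 (a.apply s)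
  | seq {P Q : RAMProg} {s₁ s₂ s₃ : RAMState} {T₁ T₂ : ℕ}
      (h₁ : RAMExec P s₁ T₁ s₂) (h₂ : RAMExec Q s₂ T₂ s₃) : RAMExec (.seq P Q) s₁ (T₁ + T₂) s₃
  | iteTrue {i : ℕ} {P Q : RAMProg} {s s' : RAMState} {T : ℕ} (hi : s.reg i ≠ 0)
      (h : RAMExec P s T s') : RAMExec (.ite i P Q) s (T + 1) s'
  | iteFalse {i : ℕ} {P Q : RAMProg} {s s' : RAMState} {T : ℕ} (hi : s.reg i = 0)
      (h : RAMExec Q s T s') : RAMExec (.ite i P Q) s (T + 1) s'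
  | whileTrue {i : ℕ} {P : RAMProg} {s₁ s₂ s₃ : RAMState} {T₁ T₂ : ℕ} (hi : s₁.reg i ≠ 0)
      (h₁ : RAMExec P s₁ T₁ s₂) (h₂ : RAMExec (.while i P) s₂ T₂ s₃) :
      RAMExec (.while i P) s₁ (T₁ + T₂ + 1) s₃
  | whileFalse {i : ℕ} {P : RAMProg} {s : RAMState} (hi : s.reg i = 0) :
      RAMExec (.while i P) s 1 s

/-- The state `s` holds the instance `(G, k)`: register `0` holds the number `n` of vertices,
register `1` holds `k`, and the memory starts with the adjacency matrix of `G`, row by row. -/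
def RAMState.Holds (s : RAMState) {n : ℕ} (G : SimpleGraph (Fin n)) (k : ℕ) : Prop :=
  s.reg 0 = n ∧ s.reg 1 = k ∧
    ∀ i j : Fin n, (G.Adj i j → s.mem (i * n + j) = 1) ∧ (¬ G.Adj i j → s.mem (i * n + j) = 0)

/-- The state `s` is the initial state for `(G, k)`: it holds `(G, k)`, and zeros elsewhere. -/
def RAMState.IsInitial (s : RAMState) {n : ℕ} (G : SimpleGraph (Fin n)) (k : ℕ) : Prop :=
  s.Holds G k ∧ (∀ i, 2 ≤ i → s.reg i = 0) ∧ ∀ a, n * n ≤ a → s.mem a = 0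

/-- The size of an instance: the adjacency matrix, and `k` in binary. -/
def instanceSize (n k : ℕ) : ℕ := n * n + Nat.size k

/-! ### Kernels -/

/-- The parameterized graph problem `Q` (instance `(G, k)`, parameter `k`) has a problem kernel with
at most `f k` vertices: an algorithm that runs in time polynomial in the size of the instance turns
each `(G, k)` into an equivalent instance `(G', k')` in which `G'` has at most `f k` vertices and
`k' ≤ k`. -/
def HasKernel (Q : ∀ n : ℕ, SimpleGraph (Fin n) → ℕ → Prop) (f : ℕ → ℕ) : Prop :=
  ∃ (P : RAMProg) (p : Polynomial ℕ), ∀ (n : ℕ) (G : SimpleGraph (Fin n)) (k : ℕ) (s : RAMState),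
    s.IsInitial G k →
      ∃ (T : ℕ) (s' : RAMState), RAMExec P s T s' ∧ T ≤ p.eval (instanceSize n k) ∧
        ∃ (n' : ℕ) (G' : SimpleGraph (Fin n')) (k' : ℕ),
          s'.Holds G' k' ∧ n' ≤ f k ∧ k' ≤ k ∧ (Q n G k ↔ Q n' G' k')

/-! ### A small imperative language on top of the machine -/

/-! The relevant objects are the vertex sets of copies of members of the family, each with at most r
vertices. A flower with core `C` is a collection of such sets that properly contain `C` and are
pairwise disjoint outside `C`. Put q = rk. Suppose that a member of a packing of size k properly
contains a core `C` of a flower with q petals. The other k - 1 members have at most r(k - 1) < q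
vertices, so some petal avoids all of them outside `C` and can replace the member. Vertices of `C`
keep their multiplicity, the other vertices of the petal get multiplicity 1 ≤ t, and the petal
differs from all other vertex sets because it has a vertex outside `C`. This exchange
(`exists_packing_subset`) works alike for subgraphs, induced subgraphs and identical vertex sets, so
one argument serves the three problems.

The kernel is the graph induced by a set `W` of marked vertices, with the same k. Starting from the
empty core, a flower with at most q petals is grown greedily and its vertices are marked. If it
stops with fewer than q petals, every larger set of the family around the core meets the petals
outside the core, and the procedure recurses on the core enlarged by each such vertex. In the end
every set of the family lies inside `W` or properly contains the core of a flower with q petals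
inside `W` (`hoare_mark`); exchanges then move any packing into `W` (`packing_iff_of_covered`). With
d further vertices to choose there are at most dq branches, so the number m(d) of marked vertices
satisfies m(d) = dq(1 + m(d - 1)) < d!(q + 1)^d (`markBound_lt`).

Polynomial time refers to a concrete machine, so the procedure is written in a small language with
Hoare-style rules for correctness and time. The family is fixed: the recursion is unrolled and
copies are found by at most r nested loops. -/

/-- Program variables. -/
inductive Var where
  | n | k | q | nn | i | j | out | cnt
  | y (a : ℕ)
  | x (a : ℕ)
  | num (a : ℕ)
deriving DecidableEq

/-- Numbering of the variables. -/
def Var.code : Var → ℕ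
  | n => 0
  | k => 1
  | q => 2
  | nn => 3
  | i => 4
  | j => 5
  | out => 6
  | cnt => 7
  | y a => 8 + 3 * a
  | x a => 9 + 3 * a
  | num a => 10 + 3 * a

/-- The register of a variable; the even positive registers are left for temporaries. -/
def Var.reg (x : Var) : ℕ := 2 * x.code - 1

theorem Var.code_injective : Function.Injective Var.code := by
  intro a b h
  cases a <;> cases b <;> simp only [Var.code] at h <;> first | rfl | omega | (congr 1; omega)

/-- Truncated subtraction sends code 0 to register 0, and every other code to an odd register. Thus
`n` and `k` occupy registers 0 and 1, where an instance is stored. -/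
theorem Var.reg_injective : Function.Injective Var.reg := by
  intro a b h
  by_cases ha : a.code = 0
  · by_cases hb : b.code = 0
    · exact Var.code_injective (ha.trans hb.symm)
    · simp only [Var.reg] at h; omega
  · exact Var.code_injective (by simp only [Var.reg] at h; omega)

theorem Var.reg_ne_temp (x : Var) (d : ℕ) : x.reg ≠ 2 * d + 2 := by
  simp only [Var.reg]; omega

/-- Values of the variables, and the memory. -/
@[ext]
structure Env where
  v : Var → ℕ
  m : ℕ → ℕ

/-- Change of a variable. -/
def Env.set (s : Env) (x : Var) (c : ℕ) : Env := ⟨Function.update s.v x c, s.m⟩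

/-- Change of a memory cell. -/
def Env.put (s : Env) (a c : ℕ) : Env := ⟨s.v, Function.update s.m a c⟩

@[simp] theorem Env.set_m (s : Env) (x : Var) (c : ℕ) : (s.set x c).m = s.m := rfl
@[simp] theorem Env.put_v (s : Env) (a c : ℕ) : (s.put a c).v = s.v := rfl
@[simp] theorem Env.set_v (s : Env) (x y : Var) (c : ℕ) :
    (s.set x c).v y = if y = x then c else s.v y := by
  simp [Env.set, Function.update_apply]
@[simp] theorem Env.put_m (s : Env) (a b c : ℕ) :
    (s.put a c).m b = if b = a then c else s.m b := by
  simp [Env.put, Function.update_apply]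

/-- The variables and the memory of a machine state. -/
def RAMState.env (s : RAMState) : Env := ⟨fun x => s.reg x.reg, s.mem⟩

/-- Expressions. -/
inductive Expr where
  | var (x : Var)
  | lit (c : ℕ)
  | add (a b : Expr)
  | sub (a b : Expr)
  | ld (a : Expr)

/-- The value of an expression. -/
def Expr.eval : Expr → Env → ℕ
  | var x, s => s.v x
  | lit c, _ => c
  | add a b, s => a.eval s + b.eval s
  | sub a b, s => a.eval s - b.eval s
  | ld a, s => s.m (a.eval s)

attribute [simp] Expr.eval

/-- A program that computes an expression into the temporary register number `d`. -/
def Expr.comp : Expr → ℕ → RAMProg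
  | var x, d => .instr (.move (2 * d + 2) x.reg)
  | lit c, d => .instr (.const (2 * d + 2) c)
  | add a b, d => .seq (a.comp d)
      (.seq (b.comp (d + 1)) (.instr (.add (2 * d + 2) (2 * d + 2) (2 * (d + 1) + 2))))
  | sub a b, d => .seq (a.comp d)
      (.seq (b.comp (d + 1)) (.instr (.sub (2 * d + 2) (2 * d + 2) (2 * (d + 1) + 2))))
  | ld a, d => .seq (a.comp d) (.instr (.load (2 * d + 2) (2 * d + 2)))

theorem RAMState.env_update_temp (s : RAMState) (d c : ℕ) :
    RAMState.env { s with reg := Function.update s.reg (2 * d + 2) c } = s.env := by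
  simp [RAMState.env, Var.reg_ne_temp]

theorem RAMState.env_update_var (s : RAMState) (x : Var) (c : ℕ) :
    RAMState.env { s with reg := Function.update s.reg x.reg c } = s.env.set x c := by
  ext y
  · simp [RAMState.env, Function.update_apply, Var.reg_injective.eq_iff]
  · simp [RAMState.env]

/-- The time `T` is chosen before the state, so it depends on the expression only. The temporaries
form a stack: evaluation at level `d` leaves the lower levels alone, which keeps the first operand
safe while the second is computed. -/
theorem Expr.exec_comp (e : Expr) : ∃ T, ∀ (d : ℕ) (s : RAMState), ∃ s',
    RAMExec (e.comp d) s T s' ∧ s'.env = s.env ∧ s'.reg (2 * d + 2) = e.eval s.env ∧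
      ∀ d' < d, s'.reg (2 * d' + 2) = s.reg (2 * d' + 2) := by
  have key : ∀ (s : RAMState) (d c : ℕ), ∀ d' < d,
      Function.update s.reg (2 * d + 2) c (2 * d' + 2) = s.reg (2 * d' + 2) := fun s d c d' h =>
    Function.update_of_ne (by omega) _ _
  induction e with
  | var x =>
    exact ⟨1, fun d s => ⟨_, .instr _ _, s.env_update_temp d _, Function.update_self .., key s d _⟩⟩
  | lit c =>
    exact ⟨1, fun d s => ⟨_, .instr _ _, s.env_update_temp d _, Function.update_self .., key s d _⟩⟩
  | add a b iha ihb =>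
    obtain ⟨Ta, ha⟩ := iha
    obtain ⟨Tb, hb⟩ := ihb
    refine ⟨Ta + (Tb + 1), fun d s => ?_⟩
    obtain ⟨s₁, e₁, v₁, r₁, f₁⟩ := ha d s
    obtain ⟨s₂, e₂, v₂, r₂, f₂⟩ := hb (d + 1) s₁
    refine ⟨_, .seq e₁ (.seq e₂ (.instr _ _)), ?_, ?_, fun d' h => ?_⟩
    · exact (s₂.env_update_temp d _).trans (v₂.trans v₁)
    · simp only [RAMInstr.apply, Function.update_self]
      rw [f₂ d (by omega), r₁, r₂, v₁]; rfl
    · exact (key s₂ d _ d' h).trans ((f₂ d' (by omega)).trans (f₁ d' h))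
  | sub a b iha ihb =>
    obtain ⟨Ta, ha⟩ := iha
    obtain ⟨Tb, hb⟩ := ihb
    refine ⟨Ta + (Tb + 1), fun d s => ?_⟩
    obtain ⟨s₁, e₁, v₁, r₁, f₁⟩ := ha d s
    obtain ⟨s₂, e₂, v₂, r₂, f₂⟩ := hb (d + 1) s₁
    refine ⟨_, .seq e₁ (.seq e₂ (.instr _ _)), ?_, ?_, fun d' h => ?_⟩
    · exact (s₂.env_update_temp d _).trans (v₂.trans v₁)
    · simp only [RAMInstr.apply, Function.update_self]
      rw [f₂ d (by omega), r₁, r₂, v₁]; rfl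
    · exact (key s₂ d _ d' h).trans ((f₂ d' (by omega)).trans (f₁ d' h))
  | ld a iha =>
    obtain ⟨Ta, ha⟩ := iha
    refine ⟨Ta + 1, fun d s => ?_⟩
    obtain ⟨s₁, e₁, v₁, r₁, f₁⟩ := ha d s
    refine ⟨_, .seq e₁ (.instr _ _), ?_, ?_, fun d' h => ?_⟩
    · exact (s₁.env_update_temp d _).trans v₁
    · simp only [RAMInstr.apply, Function.update_self]
      rw [r₁]
      exact congrFun (congrArg Env.m v₁) _
    · exact (key s₁ d _ d' h).trans (f₁ d' h)

/-- `x := e` -/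
def assign (x : Var) (e : Expr) : RAMProg := .seq (e.comp 0) (.instr (.move x.reg 2))

/-- `mem a := b` -/
def storeAt (a b : Expr) : RAMProg := .seq (a.comp 0) (.seq (b.comp 1) (.instr (.store 2 4)))

/-- Run `P` if `e ≠ 0`. -/
def whenNonzero (e : Expr) (P : RAMProg) : RAMProg := .seq (e.comp 0) (.ite 2 P .skip)

/-- Run `P` for `x = 0, …, n - 1`. -/
def forVar (x : Var) (P : RAMProg) : RAMProg :=
  .seq (assign x (.lit 0)) (.seq (Expr.comp (.sub (.var .n) (.var x)) 0)
    (.while 2 (.seq P (.seq (assign x (.add (.var x) (.lit 1)))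
      (Expr.comp (.sub (.var .n) (.var x)) 0)))))

/-- Total correctness in polynomial time: for each value `a` of the auxiliary parameter, started in
a state with `pre a`, the program reaches a state with `post a`, in time polynomial in `sz a`. -/
def Hoare {α : Type} (sz : α → ℕ) (pre : α → Env → Prop) (P : RAMProg) (post : α → Env → Prop) :
    Prop :=
  ∃ p : Polynomial ℕ, ∀ a s, pre a s.env →
    ∃ T s', RAMExec P s T s' ∧ T ≤ p.eval (sz a) ∧ post a s'.env

/-! ### Proof rules for total correctness with polynomial time bounds -/

namespace Hoare

variable {α β : Type} {sz : α → ℕ} {pre post mid : α → Env → Prop} {P Q : RAMProg}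

/-- The new parameter `b` may depend on the state. This turns witnesses hidden in a precondition,
such as the current set of marked vertices, into parameters for the next program; equal sizes keep
the time bound. -/
theorem conseq {szb : β → ℕ} {pre' post' : β → Env → Prop} (h : Hoare szb pre' P post')
    (H : ∀ a s, pre a s → ∃ b, szb b = sz a ∧ pre' b s ∧ ∀ s', post' b s' → post a s') :
    Hoare sz pre P post := by
  obtain ⟨p, hp⟩ := h
  refine ⟨p, fun a s hs => ?_⟩
  obtain ⟨b, hb, h₁, h₂⟩ := H a _ hs
  obtain ⟨T, s', he, hT, hpost⟩ := hp b s h₁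
  exact ⟨T, s', he, hb ▸ hT, h₂ _ hpost⟩

theorem skip (h : ∀ a s, pre a s → post a s) : Hoare sz pre .skip post :=
  ⟨1, fun a s hs => ⟨1, s, .skip s, by simp, h _ _ hs⟩⟩

theorem seq (h₁ : Hoare sz pre P mid) (h₂ : Hoare sz mid Q post) :
    Hoare sz pre (.seq P Q) post := by
  obtain ⟨p, hp⟩ := h₁
  obtain ⟨p', hp'⟩ := h₂
  refine ⟨p + p', fun a s hs => ?_⟩
  obtain ⟨T, s', he, hT, hmid⟩ := hp a s hs
  obtain ⟨T', s'', he', hT', hpost⟩ := hp' a s' hmid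
  exact ⟨_, s'', .seq he he', by rw [Polynomial.eval_add]; omega, hpost⟩

theorem exec_assign (x : Var) (e : Expr) : ∃ T, ∀ s : RAMState,
    ∃ s', RAMExec (assign x e) s T s' ∧ s'.env = s.env.set x (e.eval s.env) := by
  obtain ⟨T, hT⟩ := e.exec_comp
  refine ⟨T + 1, fun s => ?_⟩
  obtain ⟨s₁, e₁, v₁, r₁, -⟩ := hT 0 s
  refine ⟨_, .seq e₁ (.instr _ _), ?_⟩
  rw [← v₁] at r₁ ⊢
  exact (s₁.env_update_var x _).trans (congrArg _ r₁)

theorem assign (x : Var) (e : Expr) (h : ∀ a s, pre a s → post a (s.set x (e.eval s))) :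
    Hoare sz pre (assign x e) post := by
  obtain ⟨T, hT⟩ := exec_assign x e
  refine ⟨Polynomial.C T, fun a s hs => ?_⟩
  obtain ⟨s', he, hv⟩ := hT s
  exact ⟨T, s', he, by simp, hv ▸ h _ _ hs⟩

theorem storeAt (e f : Expr) (h : ∀ a s, pre a s → post a (s.put (e.eval s) (f.eval s))) :
    Hoare sz pre (storeAt e f) post := by
  obtain ⟨T, hT⟩ := e.exec_comp
  obtain ⟨T', hT'⟩ := f.exec_comp
  refine ⟨Polynomial.C (T + (T' + 1)), fun a s hs => ?_⟩
  obtain ⟨s₁, e₁, v₁, r₁, -⟩ := hT 0 s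
  obtain ⟨s₂, e₂, v₂, r₂, f₂⟩ := hT' 1 s₁
  refine ⟨_, _, .seq e₁ (.seq e₂ (.instr _ _)), by simp, ?_⟩
  have h₂ : s₂.reg 2 = e.eval s.env := (f₂ 0 (by omega)).trans r₁
  have h₄ : s₂.reg 4 = f.eval s.env := r₂.trans (by rw [v₁])
  have : (RAMInstr.apply (.store 2 4) s₂).env = s.env.put (e.eval s.env) (f.eval s.env) := by
    rw [← h₂, ← h₄, ← v₁, ← v₂]; rfl
  rw [this]
  exact h _ _ hs

theorem whenNonzero (e : Expr) (h : Hoare sz (fun a s => pre a s ∧ e.eval s ≠ 0) P post)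
    (h0 : ∀ a s, pre a s → e.eval s = 0 → post a s) : Hoare sz pre (whenNonzero e P) post := by
  obtain ⟨T, hT⟩ := e.exec_comp
  obtain ⟨p, hp⟩ := h
  refine ⟨Polynomial.C (T + 2) + p, fun a s hs => ?_⟩
  obtain ⟨s₁, e₁, v₁, r₁, -⟩ := hT 0 s
  by_cases hc : e.eval s.env = 0
  · exact ⟨_, s₁, .seq e₁ (.iteFalse (r₁.trans hc) (.skip _)), by simp,
      by rw [v₁]; exact h0 _ _ hs hc⟩
  · obtain ⟨T', s', he, hT', hpost⟩ := hp a s₁ (by rw [v₁]; exact ⟨hs, hc⟩)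
    refine ⟨_, s', .seq e₁ (.iteTrue (fun h' => hc (r₁.symm.trans h')) he), ?_, hpost⟩
    rw [Polynomial.eval_add, Polynomial.eval_C]; omega

/-- The tested register holds `n - x` and is recomputed after each round, so there are exactly `sz
a` rounds and the bound of the body is multiplied by the indeterminate. The body may overwrite all
temporaries but must leave `x` at its value. -/
theorem forVar (x : Var) (Inv : α → ℕ → Env → Prop)
    (hn : ∀ a i s, Inv a i s → s.v .n = sz a)
    (h0 : ∀ a s, pre a s → Inv a 0 (s.set x 0))
    (body : Hoare (fun b : α × ℕ => sz b.1) (fun b s => b.2 < sz b.1 ∧ s.v x = b.2 ∧ Inv b.1 b.2 s)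
      P (fun b s => s.v x = b.2 ∧ Inv b.1 (b.2 + 1) (s.set x (b.2 + 1))))
    (hpost : ∀ a s, Inv a (sz a) s → post a s) :
    Hoare sz pre (forVar x P) post := by
  obtain ⟨T₀, hT₀⟩ := exec_assign x (.lit 0)
  obtain ⟨T₁, hT₁⟩ := exec_assign x (.add (.var x) (.lit 1))
  obtain ⟨T₂, hT₂⟩ := Expr.exec_comp (.sub (.var .n) (.var x))
  obtain ⟨p, hp⟩ := body
  have loop : ∀ a d i (s : RAMState), i + d = sz a → s.env.v x = i → Inv a i s.env →
      s.reg 2 = d → ∃ T s', RAMExec (.while 2 (.seq P (.seq (_root_.assign x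
        (.add (.var x) (.lit 1))) (Expr.comp (.sub (.var .n) (.var x)) 0)))) s T s' ∧
        T ≤ d * (p.eval (sz a) + (T₁ + T₂ + 1)) + 1 ∧ post a s'.env := by
    intro a d
    induction d with
    | zero =>
      intro i s hi hx hI hr
      exact ⟨1, s, .whileFalse hr, by omega, hpost _ _ ((Nat.add_zero i).symm.trans hi ▸ hI)⟩
    | succ d ih =>
      intro i s hi hx hI hr
      obtain ⟨Tb, s₁, e₁, hTb, hx₁, hI₁⟩ := hp (a, i) s ⟨by dsimp only; omega, hx, hI⟩
      obtain ⟨s₂, e₂, v₂⟩ := hT₁ s₁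
      obtain ⟨s₃, e₃, v₃, r₃, -⟩ := hT₂ 0 s₂
      dsimp only at hx₁ hI₁ hTb
      have hv : s₃.env = s₁.env.set x (i + 1) := by
        rw [v₃, v₂]; simp only [Expr.eval, hx₁]
      have hI₃ : Inv a (i + 1) s₃.env := hv ▸ hI₁
      have hx₃ : s₃.env.v x = i + 1 := by rw [hv]; simp
      have hr₃ : s₃.reg 2 = d := by
        refine r₃.trans ?_
        rw [← v₃]
        simp only [Expr.eval, hn _ _ _ hI₃, hx₃]; omega
      obtain ⟨T', s', e', hT', hs'⟩ := ih (i + 1) s₃ (by omega) hx₃ hI₃ hr₃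
      refine ⟨_, s', .whileTrue (by omega) (.seq e₁ (.seq e₂ e₃)) e', ?_, hs'⟩
      rw [Nat.succ_mul]; omega
  refine ⟨Polynomial.C (T₀ + T₂) + (Polynomial.X * (p + Polynomial.C (T₁ + T₂ + 1)) + 1),
    fun a s hs => ?_⟩
  obtain ⟨s₁, e₁, v₁⟩ := hT₀ s
  obtain ⟨s₂, e₂, v₂, r₂, -⟩ := hT₂ 0 s₁
  have hv : s₂.env = s.env.set x 0 := by rw [v₂, v₁]; rfl
  have hI : Inv a 0 s₂.env := hv ▸ h0 _ _ hs
  have hx : s₂.env.v x = 0 := by rw [hv]; simp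
  obtain ⟨T, s', e', hT, hs'⟩ := loop a (sz a) 0 s₂ (by omega) hx hI (by
    refine r₂.trans ?_
    rw [← v₂]
    simp only [Expr.eval, hn _ _ _ hI, hx]; omega)
  refine ⟨_, s', .seq e₁ (.seq e₂ e'), ?_, hs'⟩
  simp only [Polynomial.eval_add, Polynomial.eval_mul, Polynomial.eval_C, Polynomial.eval_X,
    Polynomial.eval_one]
  omega

end Hoare

/-- Run `f i` for all `i` in a list. -/
def seqList {ι : Type} (f : ι → RAMProg) : List ι → RAMProg
  | [] => .skip
  | i :: l => .seq (f i) (seqList f l)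

/-- Run `P` for all values below `n` of the variables `y 0, …, y (m - 1)`. -/
def forTuples : ℕ → RAMProg → RAMProg
  | 0, P => P
  | m + 1, P => forVar (.y m) (forTuples m P)

namespace Hoare

variable {α : Type} {sz : α → ℕ} {P : RAMProg}

theorem seqList {ι : Type} (f : ι → RAMProg) (Inv : Set ι → α → Env → Prop) (l : List ι)
    (step : ∀ i ∈ l, ∀ D, Hoare sz (Inv D) (f i) (Inv (insert i D))) :
    ∀ D, Hoare sz (Inv D) (seqList f l) (Inv (D ∪ {i | i ∈ l})) := by
  induction l with
  | nil => exact fun D => .skip fun a s h => by simpa using h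
  | cons i l ih =>
    intro D
    refine (step i (by simp) D).seq ?_
    convert ih (fun j hj => step j (by simp [hj])) (insert i D) using 2
    ext j; simp only [Set.mem_union, Set.mem_insert_iff, Set.mem_ofPred_eq, List.mem_cons]; tauto

/-- The set argument of `Inv` collects the tuples already tried. Coordinates from `m` on are fixed
by the outer loops and given by the auxiliary tuple; the inner loops run through all values of the
others. -/
theorem forTuples (Inv : α → Set (ℕ → ℕ) → Env → Prop) (M : ℕ)
    (anti : ∀ a D D' s, D' ⊆ D → Inv a D s → Inv a D' s)
    (hn : ∀ a D s, Inv a D s → s.v .n = sz a)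
    (hy : ∀ a D s i c, Inv a D s → Inv a D (s.set (.y i) c))
    (body : Hoare (fun b : α × Set (ℕ → ℕ) × (ℕ → ℕ) => sz b.1)
      (fun b s => Inv b.1 b.2.1 s ∧ (∀ i, s.v (.y i) = b.2.2 i) ∧ ∀ i < M, b.2.2 i < sz b.1) P
      (fun b s => Inv b.1 (insert b.2.2 b.2.1) s ∧ ∀ i, s.v (.y i) = b.2.2 i))
    (m : ℕ) (hm : m ≤ M) :
    Hoare (fun b : α × Set (ℕ → ℕ) × (ℕ → ℕ) => sz b.1)
      (fun b s => Inv b.1 b.2.1 s ∧ (∀ i ≥ m, s.v (.y i) = b.2.2 i) ∧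
        ∀ i < M, m ≤ i → b.2.2 i < sz b.1)
      (forTuples m P)
      (fun b s => Inv b.1 (b.2.1 ∪ {t | (∀ i < m, t i < sz b.1) ∧ ∀ i ≥ m, t i = b.2.2 i}) s ∧
        ∀ i ≥ m, s.v (.y i) = b.2.2 i) := by
  induction m with
  | zero =>
    refine body.conseq ?_
    rintro ⟨a, D, t⟩ s ⟨h, ht, hb⟩
    refine ⟨(a, D, t), rfl, ⟨h, fun i => ht i (by omega), fun i hi => hb i hi (by omega)⟩, ?_⟩
    rintro s' ⟨h', ht'⟩
    refine ⟨anti _ _ _ _ ?_ h', fun i _ => ht' i⟩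
    rintro t' (h₁ | ⟨-, h₁⟩)
    · exact Or.inr h₁
    · exact Or.inl (funext fun i => h₁ i (by omega))
  | succ m ih =>
    refine .forVar (.y m) (fun b i s =>
      Inv b.1 (b.2.1 ∪ {t | (∀ j < m, t j < sz b.1) ∧ t m < i ∧ ∀ j > m, t j = b.2.2 j}) s ∧
        (∀ j > m, s.v (.y j) = b.2.2 j) ∧ ∀ j < M, m < j → b.2.2 j < sz b.1)
      (fun b i s h => hn _ _ _ h.1) ?_ ?_ ?_
    · rintro ⟨a, D, t⟩ s ⟨h, ht, hb⟩
      refine ⟨hy _ _ _ _ _ (anti _ _ _ _ ?_ h), fun j hj => ?_, fun j hj hj' => hb j hj hj'⟩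
      · rintro t' (h₁ | ⟨-, h₁, -⟩)
        · exact h₁
        · omega
      · rw [Env.set_v, if_neg (by simp; omega)]; exact ht j hj
    · refine (ih (by omega)).conseq ?_
      rintro ⟨⟨a, D, t⟩, i⟩ s ⟨hi, hx, h, ht, hb⟩
      dsimp only at hi hx h ht hb
      -- In this round coordinate `m` is frozen at `i`, so the inner loops treat the tuples with
      -- that coordinate.
      refine ⟨(a, _, Function.update t m i), rfl, ⟨h, fun j hj => ?_, fun j hj hj' => ?_⟩, ?_⟩
      · rcases Nat.eq_or_lt_of_le hj with rfl | hj
        · simpa using hx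
        · dsimp only
          rw [Function.update_of_ne (by omega)]; exact ht j hj
      · rcases Nat.eq_or_lt_of_le hj' with rfl | hj'
        · simpa using hi
        · dsimp only
          rw [Function.update_of_ne (by omega)]; exact hb j hj hj'
      · rintro s' ⟨h', ht'⟩
        dsimp only at h' ht'
        refine ⟨by simpa using ht' m le_rfl, hy _ _ _ _ _ (anti _ _ _ _ ?_ h'), fun j hj => ?_, hb⟩
        · rintro t' (h₁ | ⟨h₁, h₂, h₃⟩)
          · exact Or.inl (Or.inl h₁)
          · rcases Nat.eq_or_lt_of_le (Nat.le_of_lt_succ h₂) with h₄ | h₄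
            · refine Or.inr ⟨h₁, fun j hj => ?_⟩
              rcases Nat.eq_or_lt_of_le hj with rfl | hj
              · simpa using h₄
              · rw [Function.update_of_ne (by omega)]; exact h₃ j hj
            · exact Or.inl (Or.inr ⟨h₁, h₄, h₃⟩)
        · rw [Env.set_v, if_neg (by simp; omega), ht' j hj.le, Function.update_of_ne (by omega)]
    · rintro ⟨a, D, t⟩ s ⟨h, ht, -⟩
      refine ⟨anti _ _ _ _ ?_ h, fun j hj => ht j hj⟩
      rintro t' (h₁ | ⟨h₁, h₂⟩)
      · exact Or.inl h₁
      · exact Or.inr ⟨fun j hj => h₁ j (by omega), h₁ m (by omega), fun j hj => h₂ j hj⟩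

end Hoare

/-! ### Expressions -/

namespace Expr

/-- The sum of a list of expressions. -/
def sum : List Expr → Expr
  | [] => .lit 0
  | e :: l => .add e (sum l)

theorem eval_sum_eq_zero {l : List Expr} {s : Env} :
    (sum l).eval s = 0 ↔ ∀ e ∈ l, e.eval s = 0 := by
  induction l with
  | nil => simp [sum]
  | cons e l ih => simp [sum, ih]

/-- A multiple of an expression. -/
def smul : ℕ → Expr → Expr
  | 0, _ => .lit 0
  | c + 1, e => .add (smul c e) e

@[simp] theorem eval_smul (c : ℕ) (e : Expr) (s : Env) : (smul c e).eval s = c * e.eval s := by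
  induction c with
  | zero => simp [smul]
  | succ c ih => simp [smul, ih, Nat.succ_mul]

/-- `1` if two expressions are equal, and `0` otherwise. -/
def eq (a b : Expr) : Expr := .sub (.lit 1) (.add (.sub a b) (.sub b a))

@[simp] theorem eval_eq_eq_zero {a b : Expr} {s : Env} :
    (eq a b).eval s = 0 ↔ a.eval s ≠ b.eval s := by
  simp only [eq, eval]; omega

/-- `1` if an expression is `0`, and `0` otherwise. -/
def isZero (a : Expr) : Expr := .sub (.lit 1) a

@[simp] theorem eval_isZero_eq_zero {a : Expr} {s : Env} :
    (isZero a).eval s = 0 ↔ a.eval s ≠ 0 := by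
  simp only [isZero, eval]; omega

/-- The address of entry `e` of the array number `a`; the arrays are interleaved. -/
def cell (J a : ℕ) (e : Expr) : Expr := .add (.var .nn) (.add (smul J e) (.lit a))

/-- The entry of the adjacency matrix in the row and column given by two variables. -/
def adj (J : ℕ) (u v : Var) : Expr := .ld (.add (.ld (cell J 1 (.var u))) (.var v))

end Expr

/-- The address of entry `v` of the array number `a`, for a graph with `n` vertices. -/
def addr (n J a v : ℕ) : ℕ := n * n + (J * v + a)

/-- The residue modulo `J` recovers the array, and then the entry follows. Interleaving needs only
multiplication by the constant `J`, which is repeated addition. -/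
theorem addr_inj {n J a a' v v' : ℕ} (ha : a < J) (ha' : a' < J) :
    addr n J a v = addr n J a' v' ↔ a = a' ∧ v = v' := by
  constructor
  · intro h
    have h' : J * v + a = J * v' + a' := by simp only [addr] at h; omega
    have h₁ := congrArg (· % J) h'
    simp only [Nat.mul_add_mod, Nat.mod_eq_of_lt ha, Nat.mod_eq_of_lt ha'] at h₁
    subst h₁
    exact ⟨rfl, Nat.eq_of_mul_eq_mul_left (by omega : 0 < J) (by omega)⟩
  · rintro ⟨rfl, rfl⟩; rfl

theorem index_lt {n x y : ℕ} (hx : x < n) (hy : y < n) : x * n + y < n * n := by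
  have := Nat.mul_le_mul_right n (Nat.succ_le_of_lt hx)
  rw [Nat.succ_mul] at this; omega

open Finset

/-! ### Flowers -/

section Flower

variable {V : Type} [DecidableEq V]

/-- The sets in `P` belong to the family, properly contain `C`, and are disjoint outside `C`; their
union outside `C` is `U`. -/
structure Flower (F : Finset V → Prop) (C : Finset V) (P : Finset (Finset V)) (U : Finset V) :
    Prop where
  mem : ∀ B ∈ P, F B ∧ C ⊂ B
  disj : ∀ B ∈ P, ∀ B' ∈ P, B ≠ B' → B ∩ B' ⊆ C
  union : U = P.biUnion (· \ C)

/-- The set `S` is inside `W`, or redundant because of a flower with `q` petals inside `W`. -/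
def Covered (F : Finset V → Prop) (q : ℕ) (W S : Finset V) : Prop :=
  S ⊆ W ∨ ∃ C ⊂ S, ∃ P U, Flower F C P U ∧ q ≤ #P ∧ ∀ B ∈ P, B ⊆ W

theorem Covered.mono {F : Finset V → Prop} {q : ℕ} {W W' S : Finset V} (h : Covered F q W S)
    (hW : W ⊆ W') : Covered F q W' S := by
  rcases h with h | ⟨C, hC, P, U, hP, hq, hB⟩
  · exact Or.inl (h.trans hW)
  · exact Or.inr ⟨C, hC, P, U, hP, hq, fun B h => (hB B h).trans hW⟩

variable {F : Finset V → Prop} {C U : Finset V} {P : Finset (Finset V)}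

theorem Flower.empty : Flower F C ∅ ∅ := ⟨by simp, by simp, by simp⟩

theorem Flower.disjoint (h : Flower F C P U) : Disjoint C U := by
  rw [h.union, disjoint_left]
  intro v hv hv'
  simp only [mem_biUnion, mem_sdiff] at hv'
  obtain ⟨_, _, _, h⟩ := hv'
  exact h hv

theorem Flower.subset (h : Flower F C P U) {B : Finset V} (hB : B ∈ P) : B ⊆ C ∪ U := by
  intro v hv
  by_cases hc : v ∈ C
  · exact mem_union_left _ hc
  · exact mem_union_right _ (h.union ▸ mem_biUnion.2 ⟨B, hB, mem_sdiff.2 ⟨hv, hc⟩⟩)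

theorem Flower.card_le (h : Flower F C P U) {d : ℕ} (hd : ∀ B, F B → #B ≤ #C + d) :
    #U ≤ #P * d := by
  rw [h.union]
  refine card_biUnion_le_card_mul _ _ _ fun B hB => ?_
  rw [card_sdiff_of_subset (h.mem B hB).2.subset]
  have := hd B (h.mem B hB).1
  omega

/-- Earlier petals lie in `C ∪ U`, so a set that avoids `U` meets them inside `C` only. Hence the
program needs to store only `U`, not the individual petals. -/
theorem Flower.insert (h : Flower F C P U) {B : Finset V} (hB : F B) (hC : C ⊂ B)
    (hU : Disjoint B U) : Flower F C (insert B P) (U ∪ (B \ C)) := by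
  have key : ∀ B' ∈ P, B ∩ B' ⊆ C := by
    intro B' hB' v hv
    rw [mem_inter] at hv
    rcases mem_union.1 (h.subset hB' hv.2) with h' | h'
    · exact h'
    · exact absurd h' (disjoint_left.1 hU hv.1)
  refine ⟨fun B' hB' => ?_, fun B₁ h₁ B₂ h₂ hne => ?_, ?_⟩
  · rcases mem_insert.1 hB' with rfl | hB'
    · exact ⟨hB, hC⟩
    · exact h.mem B' hB'
  · rcases mem_insert.1 h₁ with rfl | h₁' <;> rcases mem_insert.1 h₂ with rfl | h₂'
    · exact absurd rfl hne
    · exact key _ h₂'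
    · rw [inter_comm]; exact key _ h₁'
    · exact h.disj _ h₁' _ h₂' hne
  · rw [biUnion_insert, ← h.union, union_comm]

theorem Flower.notMem (h : Flower F C P U) {B : Finset V} (hC : C ⊂ B) (hU : Disjoint B U) :
    B ∉ P := by
  intro hB
  obtain ⟨v, hv, hv'⟩ := exists_of_ssubset hC
  exact disjoint_left.1 hU hv (h.union ▸ mem_biUnion.2 ⟨B, hB, mem_sdiff.2 ⟨hv, hv'⟩⟩)

end Flower

/-! ### States of the marking program -/

/-- The input of a call of the marking program: the instance, the number `q` of petals, the vertices
`xs 0, xs 1, …` of the core, the set `W` of marked vertices, and the arrays of the callers. -/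
structure Frame where
  (n q k : ℕ)
  A : ℕ → ℕ → ℕ
  xs : ℕ → ℕ
  W : Finset ℕ
  Us : ℕ → ℕ → ℕ

namespace Frame

/-- The core of a call at depth `c`. -/
def core (g : Frame) (c : ℕ) : Finset ℕ := (range c).image g.xs

/-- The state agrees with the frame at depth `c`, with `W` as set of marked vertices. -/
structure Lev (J c : ℕ) (g : Frame) (W : Finset ℕ) (s : Env) : Prop where
  n : s.v .n = g.n
  k : s.v .k = g.k
  q : s.v .q = g.q
  nn : s.v .nn = g.n * g.n
  adj : ∀ u < g.n, ∀ v < g.n, s.m (u * g.n + v) = g.A u v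
  row : ∀ u < g.n, s.m (addr g.n J 1 u) = u * g.n
  x : ∀ l < c, s.v (.x l) = g.xs l
  W : ∀ v < g.n, s.m (addr g.n J 0 v) ≠ 0 ↔ v ∈ W
  U : ∀ l < c, ∀ v < g.n, s.m (addr g.n J (2 + l) v) = g.Us l v

variable {J c : ℕ} {g : Frame} {W : Finset ℕ} {s : Env}

theorem Lev.set (h : Lev J c g W s) {z : Var}
    (hz : (∃ i, z = .y i) ∨ (∃ i, z = .num i) ∨ ∃ i ≥ c, z = .x i) (e : ℕ) :
    Lev J c g W (s.set z e) := by
  have hx : ∀ l < c, Var.x l ≠ z := by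
    rintro l hl rfl
    rcases hz with ⟨i, hi⟩ | ⟨i, hi⟩ | ⟨i, hi, hi'⟩
    · cases hi
    · cases hi
    · cases hi'; omega
  have hz' : Var.n ≠ z ∧ Var.k ≠ z ∧ Var.q ≠ z ∧ Var.nn ≠ z := by
    rcases hz with ⟨i, rfl⟩ | ⟨i, rfl⟩ | ⟨i, _, rfl⟩ <;> simp
  exact ⟨by simp [hz', h.n], by simp [hz', h.k], by simp [hz', h.q], by simp [hz', h.nn], h.adj,
    h.row, fun l hl => by simp [hx l hl, h.x l hl], h.W, h.U⟩

/-- A call at depth `c` owns the arrays from `2 + c` on. Array 0 holds the marks, array 1 the row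
offsets, and the arrays between belong to the callers. -/
theorem Lev.put (h : Lev J c g W s) {a : ℕ} (ha : 2 + c ≤ a) (haJ : a < J) (v e : ℕ) :
    Lev J c g W (s.put (addr g.n J a v) e) := by
  refine ⟨h.n, h.k, h.q, h.nn, fun u hu w hw => ?_, fun u hu => ?_, h.x, fun u hu => ?_,
    fun l hl u hu => ?_⟩
  · have := index_lt hu hw
    rw [Env.put_m, if_neg (by simp only [addr]; omega), h.adj u hu w hw]
  · rw [Env.put_m, if_neg (by rw [addr_inj (by omega) haJ]; omega), h.row u hu]
  · rw [Env.put_m, if_neg (by rw [addr_inj (by omega) haJ]; omega), h.W u hu]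
  · rw [Env.put_m, if_neg (by rw [addr_inj (by omega) haJ]; omega), h.U l hl u hu]

theorem Lev.mark (h : Lev J c g W s) (hJ : 2 + c < J) (v : ℕ) {e : ℕ} (he : e ≠ 0) :
    Lev J c g (insert v W) (s.put (addr g.n J 0 v) e) := by
  refine ⟨h.n, h.k, h.q, h.nn, fun u hu w hw => ?_, fun u hu => ?_, h.x, fun u hu => ?_,
    fun l hl u hu => ?_⟩
  · have := index_lt hu hw
    rw [Env.put_m, if_neg (by simp only [addr]; omega), h.adj u hu w hw]
  · rw [Env.put_m, if_neg (by rw [addr_inj (by omega) (by omega)]; omega), h.row u hu]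
  · have h0 : 0 < J := by omega
    rw [mem_insert, ← h.W u hu]
    by_cases huv : u = v <;> simp [huv, he, addr_inj h0 h0]
  · rw [Env.put_m, if_neg (by rw [addr_inj (by omega) (by omega)]; omega), h.U l hl u hu]

theorem Lev.eval_cell (h : Lev J c g W s) (a : ℕ) (e : Expr) :
    (Expr.cell J a e).eval s = addr g.n J a (e.eval s) := by
  simp [Expr.cell, addr, h.nn]

theorem Lev.eval_adj (h : Lev J c g W s) {u v : Var} (hu : s.v u < g.n) (hv : s.v v < g.n) :
    (Expr.adj J u v).eval s = g.A (s.v u) (s.v v) := by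
  simp only [Expr.adj, Expr.eval, h.eval_cell, h.row _ hu, h.adj _ hu _ hv]

end Frame

/-! ### Copies of the graphs of the family -/

/-- The numbers `t 0, t 1, …` are the vertices of a copy of `H` in the graph with adjacency matrix
`A`; if `ind` is set, of an induced copy. -/
def IsCopy (ind : Bool) (A : ℕ → ℕ → ℕ) (H : Σ m : ℕ, SimpleGraph (Fin m)) (t : ℕ → ℕ) : Prop :=
  ∀ i j : Fin H.1, i ≠ j → t i ≠ t j ∧ (H.2.Adj i j → A (t i) (t j) ≠ 0) ∧
    (¬ H.2.Adj i j → ind = true → A (t i) (t j) = 0)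

theorem IsCopy.card {ind : Bool} {A : ℕ → ℕ → ℕ} {H : Σ m : ℕ, SimpleGraph (Fin m)} {t : ℕ → ℕ}
    (h : IsCopy ind A H t) : #((range H.1).image t) = H.1 := by
  rw [card_image_of_injOn, card_range]
  intro i hi j hj hij
  by_contra hne
  exact (h ⟨i, by simpa using hi⟩ ⟨j, by simpa using hj⟩ (by simpa using hne)).1 hij

/-- The vertex sets of the copies of members of the family. -/
def Frame.Fam (ind : Bool) (l : List (Σ m : ℕ, SimpleGraph (Fin m))) (g : Frame) (S : Finset ℕ) :
    Prop :=
  ∃ H ∈ l, ∃ t : ℕ → ℕ, (∀ i < H.1, t i < g.n) ∧ IsCopy ind g.A H t ∧ S = (range H.1).image t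

open Classical in
/-- An expression that is `0` if and only if the variables `y` hold a copy of `H`. -/
noncomputable def copyTest (J : ℕ) (ind : Bool) (H : Σ m : ℕ, SimpleGraph (Fin m)) : Expr :=
  .sum ((List.finRange H.1).map fun i : Fin H.1 => .sum ((List.finRange H.1).map fun j : Fin H.1 =>
    if i = j then .lit 0 else
      .add (.eq (.var (.y i)) (.var (.y j)))
        (if H.2.Adj i j then .isZero (.adj J (.y i) (.y j))
          else if ind then .adj J (.y i) (.y j) else .lit 0)))

theorem Frame.Lev.eval_copyTest {J c : ℕ} {g : Frame} {W : Finset ℕ} {s : Env}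
    (h : Frame.Lev J c g W s) (ind : Bool) (H : Σ m : ℕ, SimpleGraph (Fin m))
    (hy : ∀ i < H.1, s.v (.y i) < g.n) :
    (copyTest J ind H).eval s = 0 ↔ IsCopy ind g.A H fun i => s.v (.y i) := by
  simp only [copyTest, Expr.eval_sum_eq_zero, List.forall_mem_map, List.mem_finRange,
    forall_true_left, IsCopy]
  refine forall_congr' fun i => forall_congr' fun j => ?_
  have hA := h.eval_adj (hy i i.2) (hy j j.2)
  by_cases hij : i = j
  · simp [hij]
  · simp only [hij, if_false, not_false_eq_true, forall_true_left, ne_eq, Expr.eval,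
      Expr.eval_eq_eq_zero, Nat.add_eq_zero_iff]
    refine and_congr (by simp) ?_
    by_cases hH : H.2.Adj i j
    · simp [hH, hA]
    · cases ind <;> simp [hH, hA]

/-- An expression that is nonzero if and only if the variables `y` hold a copy of `H` which contains
the core and is disjoint from the petals found so far, and there are less than `q` petals. -/
noncomputable def fitTest (J : ℕ) (ind : Bool) (c : ℕ) (H : Σ m : ℕ, SimpleGraph (Fin m)) : Expr :=
  .isZero (.sum [copyTest J ind H, .isZero (.sub (.var .q) (.var (.num c))),
    .sum ((List.range c).map fun l => .isZero
      (.sum ((List.range H.1).map fun i => .eq (.var (.x l)) (.var (.y i))))),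
    .sum ((List.range H.1).map fun i => .ld (.cell J (2 + c) (.var (.y i))))])

/-- The state during the search for petals at depth `c`: the set `U` of vertices in petals is stored
in an array, and their number `p` in a variable. -/
structure Frame.Search (J c : ℕ) (g : Frame) (W U : Finset ℕ) (p : ℕ) (s : Env) : Prop where
  lev : g.Lev J c W s
  arr : ∀ v < g.n, s.m (addr g.n J (2 + c) v) ≠ 0 ↔ v ∈ U
  num : s.v (.num c) = p

theorem Frame.Search.eval_fitTest {J c p : ℕ} {g : Frame} {W U : Finset ℕ} {s : Env}
    (h : g.Search J c W U p s) (ind : Bool) (H : Σ m : ℕ, SimpleGraph (Fin m))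
    (hy : ∀ i < H.1, s.v (.y i) < g.n) :
    (fitTest J ind c H).eval s ≠ 0 ↔ IsCopy ind g.A H (fun i => s.v (.y i)) ∧ p < g.q ∧
      g.core c ⊆ (range H.1).image (fun i => s.v (.y i)) ∧
      Disjoint ((range H.1).image (fun i => s.v (.y i))) U := by
  have hU : Disjoint ((range H.1).image (fun i => s.v (.y i))) U ↔
      ∀ i < H.1, s.m (addr g.n J (2 + c) (s.v (.y i))) = 0 := by
    simp only [disjoint_left, mem_image, mem_range, forall_exists_index, and_imp,
      forall_apply_eq_imp_iff₂]
    exact forall₂_congr fun i hi => by rw [← h.arr _ (hy i hi), not_not]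
  have hC : g.core c ⊆ (range H.1).image (fun i => s.v (.y i)) ↔
      ∀ l < c, ∃ i < H.1, s.v (.x l) = s.v (.y i) := by
    simp only [subset_iff, Frame.core, mem_image, mem_range, forall_exists_index, and_imp,
      forall_apply_eq_imp_iff₂]
    exact forall₂_congr fun l hl => by simp only [h.lev.x l hl, eq_comm]
  rw [hU, hC, ← h.lev.eval_copyTest ind H hy]
  simp [fitTest, Expr.eval_sum_eq_zero, h.lev.eval_cell, h.num, h.lev.q, Nat.sub_eq_zero_iff_le]

/-- Mark the vertices `y 0, …, y (m - 1)`, and add those outside the core to the petals. -/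
def takeTuple (J c : ℕ) : ℕ → RAMProg
  | 0 => .skip
  | i + 1 => .seq (takeTuple J c i)
      (.seq (storeAt (.cell J 0 (.var (.y i))) (.lit 1))
        (storeAt (.cell J (2 + c) (.var (.y i)))
          (.isZero (.sum ((List.range c).map fun l => .eq (.var (.x l)) (.var (.y i)))))))

theorem hoare_takeTuple (J c : ℕ) (hJ : 2 + c < J) (M m : ℕ) (hm : m ≤ M) :
    Hoare (fun b : Frame × Finset ℕ × Finset ℕ × ℕ × (ℕ → ℕ) => b.1.n)
      (fun ⟨g, W, U, p, t⟩ s => (g.Search J c W U p s ∧ ∀ i, s.v (.y i) = t i) ∧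
        (∀ i < M, t i < g.n) ∧ Disjoint (g.core c) U)
      (takeTuple J c m)
      (fun ⟨g, W, U, p, t⟩ s => (g.Search J c (W ∪ (range m).image t)
        (U ∪ ((range m).image t \ g.core c)) p s ∧ ∀ i, s.v (.y i) = t i) ∧
        (∀ i < M, t i < g.n) ∧ Disjoint (g.core c) U) := by
  induction m with
  | zero =>
    refine .skip ?_
    rintro ⟨g, W, U, p, t⟩ s ⟨⟨h, hy⟩, ht, hd⟩
    exact ⟨⟨by simpa using h, hy⟩, ht, hd⟩
  | succ m ih =>
    refine (ih (by omega)).seq (.seq (mid := fun ⟨g, W, U, p, t⟩ s =>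
      (g.Search J c (W ∪ (range (m + 1)).image t)
        (U ∪ ((range m).image t \ g.core c)) p s ∧ ∀ i, s.v (.y i) = t i) ∧
        (∀ i < M, t i < g.n) ∧ Disjoint (g.core c) U) (.storeAt _ _ ?_) (.storeAt _ _ ?_))
    · rintro ⟨g, W, U, p, t⟩ s ⟨⟨h, hy⟩, ht, hd⟩
      refine ⟨⟨⟨?_, fun v hv => ?_, h.num⟩, hy⟩, ht, hd⟩
      · rw [h.lev.eval_cell, range_add_one, image_insert, union_insert]
        simp only [Expr.eval, hy]
        exact h.lev.mark hJ _ one_ne_zero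
      · rw [h.lev.eval_cell, Env.put_m, if_neg (by rw [addr_inj (by omega) (by omega)]; omega),
          h.arr v hv]
    · rintro ⟨g, W, U, p, t⟩ s ⟨⟨h, hy⟩, ht, hd⟩
      refine ⟨⟨⟨?_, fun v hv => ?_, h.num⟩, hy⟩, ht, hd⟩
      · rw [h.lev.eval_cell]
        exact h.lev.put le_rfl hJ _ _
      · have hC : (Expr.isZero (.sum ((List.range c).map fun l =>
            .eq (.var (.x l)) (.var (.y m))))).eval s ≠ 0 ↔ t m ∉ g.core c := by
          simp only [ne_eq, Expr.eval_isZero_eq_zero, not_not, Expr.eval_sum_eq_zero,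
            List.forall_mem_map, List.mem_range, Expr.eval_eq_eq_zero, Expr.eval, hy, Frame.core,
            mem_image, mem_range, not_exists, not_and]
          exact forall₂_congr fun l hl => by rw [h.lev.x l hl]
        rw [h.lev.eval_cell, Env.put_m, range_add_one, image_insert]
        simp only [addr_inj hJ hJ, Expr.eval, hy, true_and]
        by_cases hvt : v = t m
        · rw [if_pos hvt, hC, hvt]
          simp only [mem_union, mem_sdiff, mem_insert, true_or, true_and]
          refine ⟨Or.inr, fun h' => ?_⟩
          rcases h' with h' | h'
          · exact disjoint_right.1 hd h'
          · exact h'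
        · rw [if_neg hvt, h.arr v hv]
          simp [hvt]

/-! ### The marking program -/

/-- If the variables `y` hold a copy of `H` that extends the flower, then extend the flower. -/
noncomputable def tryTuple (J : ℕ) (ind : Bool) (c : ℕ) (H : Σ m : ℕ, SimpleGraph (Fin m)) :
    RAMProg :=
  whenNonzero (fitTest J ind c H)
    (.seq (assign (.num c) (.add (.var (.num c)) (.lit 1))) (takeTuple J c H.1))

/-- Find greedily a flower with at most `q` petals whose core has the vertices `x 0, …, x (c - 1)`,
and mark its vertices. If there are less than `q` petals, recurse on the cores that have one more
vertex, in a petal. -/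
noncomputable def markProg (J : ℕ) (ind : Bool) (l : List (Σ m : ℕ, SimpleGraph (Fin m))) :
    ℕ → ℕ → RAMProg
  | 0, _ => .skip
  | d + 1, c =>
    .seq (forVar (.x c) (storeAt (.cell J (2 + c) (.var (.x c))) (.lit 0)))
      (.seq (assign (.num c) (.lit 0))
        (.seq (seqList (fun H => forTuples H.1 (tryTuple J ind c H))
            (l.filter fun H => c < H.1))
          (whenNonzero (.sub (.var .q) (.var (.num c)))
            (forVar (.x c) (whenNonzero (.ld (.cell J (2 + c) (.var (.x c))))
              (markProg J ind l d (c + 1)))))))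

/-- A bound on the number of vertices that are marked by a call of the marking program. -/
def markBound (q : ℕ) : ℕ → ℕ
  | 0 => 0
  | d + 1 => (d + 1) * q * (1 + markBound q d)

/-- Strictness makes the induction work: it absorbs the summand 1 in the recursion. -/
theorem markBound_lt (q d : ℕ) : markBound q d < d.factorial * (q + 1) ^ d := by
  induction d with
  | zero => simp [markBound]
  | succ d ih =>
    have h : (d + 1) * q * (1 + markBound q d) ≤ (d + 1) * q * (d.factorial * (q + 1) ^ d) :=
      Nat.mul_le_mul_left _ (by omega)
    have hpos : 0 < (d + 1) * (d.factorial * (q + 1) ^ d) := by positivity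
    have e : (d + 1).factorial * (q + 1) ^ (d + 1) =
        (d + 1) * q * (d.factorial * (q + 1) ^ d) + (d + 1) * (d.factorial * (q + 1) ^ d) := by
      rw [Nat.factorial_succ]; ring
    rw [e, markBound]
    omega

theorem IsCopy.congr {ind : Bool} {A : ℕ → ℕ → ℕ} {H : Σ m : ℕ, SimpleGraph (Fin m)}
    {t t' : ℕ → ℕ} (h : IsCopy ind A H t) (ht : ∀ i < H.1, t' i = t i) : IsCopy ind A H t' := by
  intro i j hij
  rw [ht i i.2, ht j j.2]
  exact h i j hij

/-! ### Invariant and correctness of the greedy search for petals -/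

namespace Frame

/-- The core of a call at depth `c` consists of `c` marked vertices. -/
structure OK (c : ℕ) (g : Frame) : Prop where
  core : g.core c ⊆ g.W
  marked : g.W ⊆ range g.n
  card : #(g.core c) = c

/-- The invariant of the search for petals, where the pairs in `D` have been tried. -/
def PetalInv (J : ℕ) (ind : Bool) (l : List (Σ m : ℕ, SimpleGraph (Fin m))) (c : ℕ)
    (D : Set ((Σ m : ℕ, SimpleGraph (Fin m)) × (ℕ → ℕ))) (g : Frame) (s : Env) : Prop :=
  g.OK c ∧ ∃ U P, g.Search J c (g.W ∪ U) U #P s ∧ Flower (g.Fam ind l) (g.core c) P U ∧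
    #P ≤ g.q ∧ U ⊆ range g.n ∧ ∀ b ∈ D, (∀ i < b.1.1, b.2 i < g.n) → IsCopy ind g.A b.1 b.2 →
      g.core c ⊂ (range b.1.1).image b.2 → #P = g.q ∨ ¬ Disjoint ((range b.1.1).image b.2) U

variable {J c : ℕ} {g : Frame} {W U : Finset ℕ} {s : Env} {p : ℕ} {ind : Bool}
  {l : List (Σ m : ℕ, SimpleGraph (Fin m))}

theorem Search.set_y (h : g.Search J c W U p s) (i e : ℕ) :
    g.Search J c W U p (s.set (.y i) e) :=
  ⟨h.lev.set (Or.inl ⟨i, rfl⟩) e, h.arr, by simpa using h.num⟩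

theorem PetalInv.set_y {D : Set ((Σ m : ℕ, SimpleGraph (Fin m)) × (ℕ → ℕ))}
    (h : g.PetalInv J ind l c D s) (i e : ℕ) : g.PetalInv J ind l c D (s.set (.y i) e) := by
  obtain ⟨hg, U, P, h, h'⟩ := h
  exact ⟨hg, U, P, h.set_y i e, h'⟩

theorem PetalInv.anti {D D' : Set ((Σ m : ℕ, SimpleGraph (Fin m)) × (ℕ → ℕ))}
    (h : g.PetalInv J ind l c D s) (hD : D' ⊆ D) : g.PetalInv J ind l c D' s := by
  obtain ⟨hg, U, P, h₁, h₂, h₃, h₄, h₅⟩ := h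
  exact ⟨hg, U, P, h₁, h₂, h₃, h₄, fun b hb => h₅ b (hD hb)⟩

end Frame

/-- A single pass suffices for maximality: `U` only grows, so a copy that once met `U` meets it for
ever. A copy that is taken meets the new `U` in its vertices outside the core. -/
theorem hoare_tryTuple {J c : ℕ} (hJ : 2 + c < J) (ind : Bool)
    {l : List (Σ m : ℕ, SimpleGraph (Fin m))} {H : Σ m : ℕ, SimpleGraph (Fin m)} (hH : H ∈ l)
    (hc : c < H.1) (D : Set ((Σ m : ℕ, SimpleGraph (Fin m)) × (ℕ → ℕ))) :
    Hoare (fun b : Frame × Set (ℕ → ℕ) × (ℕ → ℕ) => b.1.n)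
      (fun b s => b.1.PetalInv J ind l c (D ∪ {H} ×ˢ b.2.1) s ∧ (∀ i, s.v (.y i) = b.2.2 i) ∧
        ∀ i < H.1, b.2.2 i < b.1.n)
      (tryTuple J ind c H)
      (fun b s => b.1.PetalInv J ind l c (D ∪ {H} ×ˢ insert b.2.2 b.2.1) s ∧
        ∀ i, s.v (.y i) = b.2.2 i) := by
  have take : Hoare (fun b : Frame × Finset ℕ × Finset ℕ × ℕ × (ℕ → ℕ) => b.1.n)
      (fun ⟨g, W, U, p, t⟩ s => (g.Search J c W U p s ∧ ∀ i, s.v (.y i) = t i) ∧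
        (∀ i < H.1, t i < g.n) ∧ Disjoint (g.core c) U)
      (.seq (assign (.num c) (.add (.var (.num c)) (.lit 1))) (takeTuple J c H.1))
      (fun ⟨g, W, U, p, t⟩ s => g.Search J c (W ∪ (range H.1).image t)
        (U ∪ ((range H.1).image t \ g.core c)) (p + 1) s ∧ ∀ i, s.v (.y i) = t i) := by
    refine .seq (mid := fun ⟨g, W, U, p, t⟩ s =>
      (g.Search J c W U (p + 1) s ∧ ∀ i, s.v (.y i) = t i) ∧
        (∀ i < H.1, t i < g.n) ∧ Disjoint (g.core c) U) (.assign _ _ ?_)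
      ((hoare_takeTuple J c hJ H.1 H.1 le_rfl).conseq ?_)
    · rintro ⟨g, W, U, p, t⟩ s ⟨⟨h, hy⟩, h'⟩
      exact ⟨⟨⟨h.lev.set (Or.inr (Or.inl ⟨c, rfl⟩)) _, h.arr, by simp [h.num]⟩,
        fun i => by simp [hy]⟩, h'⟩
    · rintro ⟨g, W, U, p, t⟩ s h
      exact ⟨(g, W, U, p + 1, t), rfl, h, fun s' h' => h'.1⟩
  refine .whenNonzero _ (take.conseq ?_) ?_
  · rintro ⟨g, T, t⟩ s ⟨⟨⟨hg, U, P, hS, hF, hq, hU, hD⟩, hy, ht⟩, hne⟩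
    rw [hS.eval_fitTest ind H (fun i hi => by rw [hy]; exact ht i hi), funext hy] at hne
    obtain ⟨hcopy, hlt, hcore, hdisj⟩ := hne
    dsimp only at hS hF hq hU hD hy ht hcopy hlt hcore hdisj
    refine ⟨(g, g.W ∪ U, U, #P, t), rfl, ⟨⟨hS, hy⟩, ht, hF.disjoint⟩, ?_⟩
    rintro s' ⟨hS', hy'⟩
    refine ⟨⟨hg, ?_⟩, hy'⟩
    set B := (range H.1).image t with hB
    have hBn : B ⊆ range g.n := by
      intro v hv
      obtain ⟨i, hi, rfl⟩ := mem_image.1 hv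
      exact mem_range.2 (ht i (mem_range.1 hi))
    -- The inclusion is proper by counting: the copy has `H.1 > c` vertices and the core has `c`.
    have hs : g.core c ⊂ B := Finset.ssubset_iff_subset_ne.2 ⟨hcore, fun h => by
      have := hcopy.card
      rw [← hB, ← h, hg.card] at this
      omega⟩
    have hW : g.W ∪ U ∪ B = g.W ∪ (U ∪ (B \ g.core c)) := by
      ext v
      have := @hg.core v
      simp only [mem_union, mem_sdiff]; tauto
    refine ⟨U ∪ (B \ g.core c), insert B P, ?_, hF.insert ⟨H, hH, t, ht, hcopy, hB⟩ hs hdisj,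
      ?_, union_subset hU (sdiff_subset.trans hBn), ?_⟩
    · rw [card_insert_of_notMem (hF.notMem hs hdisj), ← hW]; exact hS'
    · rw [card_insert_of_notMem (hF.notMem hs hdisj)]; exact hlt
    · rintro ⟨H', t'⟩ hb h₁ h₂ h₃
      rcases hb with hb | ⟨hH', rfl | hb⟩
      · rcases hD _ (Or.inl hb) h₁ h₂ h₃ with h | h
        · omega
        · exact Or.inr fun hd => h (hd.mono_right subset_union_left)
      · obtain rfl : H' = H := hH'
        obtain ⟨v, hv, hv'⟩ := exists_of_ssubset hs
        exact Or.inr fun hd => disjoint_left.1 hd hv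
          (mem_union_right _ (mem_sdiff.2 ⟨hv, hv'⟩))
      · rcases hD _ (Or.inr ⟨hH', hb⟩) h₁ h₂ h₃ with h | h
        · omega
        · exact Or.inr fun hd => h (hd.mono_right subset_union_left)
  · rintro ⟨g, T, t⟩ s ⟨⟨hg, U, P, hS, hF, hq, hU, hD⟩, hy, ht⟩ h0
    refine ⟨⟨hg, U, P, hS, hF, hq, hU, ?_⟩, hy⟩
    have hne := (hS.eval_fitTest ind H (fun i hi => by rw [hy]; exact ht i hi)).not
    rw [funext hy, not_not] at hne
    rintro ⟨H', t'⟩ hb h₁ h₂ h₃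
    rcases hb with hb | ⟨hH', rfl | hb⟩
    · exact hD _ (Or.inl hb) h₁ h₂ h₃
    · obtain rfl : H' = H := hH'
      by_contra hcon
      rw [not_or, not_not] at hcon
      exact hne.1 h0 ⟨h₂, lt_of_le_of_ne hq hcon.1, h₃.subset, hcon.2⟩
    · exact hD _ (Or.inr ⟨hH', hb⟩) h₁ h₂ h₃

theorem hoare_tryTuples {J c : ℕ} (hJ : 2 + c < J) (ind : Bool)
    {l : List (Σ m : ℕ, SimpleGraph (Fin m))} {H : Σ m : ℕ, SimpleGraph (Fin m)} (hH : H ∈ l)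
    (hc : c < H.1) (D : Set (Σ m : ℕ, SimpleGraph (Fin m))) :
    Hoare Frame.n (Frame.PetalInv J ind l c (D ×ˢ Set.univ)) (forTuples H.1 (tryTuple J ind c H))
      (Frame.PetalInv J ind l c (insert H D ×ˢ Set.univ)) := by
  refine (Hoare.forTuples (sz := Frame.n)
    (fun g T => g.PetalInv J ind l c (D ×ˢ Set.univ ∪ {H} ×ˢ T)) H.1
    (fun g T T' s hT h => h.anti (Set.union_subset_union_right _ (Set.prod_mono_right hT)))
    (fun g T s h => ?_) (fun g T s i e h => h.set_y i e)
    (hoare_tryTuple hJ ind hH hc _) H.1 le_rfl).conseq ?_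
  · obtain ⟨-, U, P, h, -⟩ := h
    exact h.lev.n
  · intro g s h
    refine ⟨(g, ∅, fun i => s.v (.y i)), rfl, ⟨h.anti (by simp), fun i _ => rfl, by omega⟩, ?_⟩
    rintro s' ⟨⟨hg, U, P, h₁, h₂, h₃, h₄, h₅⟩, -⟩
    refine ⟨hg, U, P, h₁, h₂, h₃, h₄, ?_⟩
    rintro ⟨H', t⟩ ⟨hb, -⟩ ht hcopy hcore
    rcases hb with rfl | hb
    -- The loops leave the variables `y` from `H.1` on at their old values. A copy depends on the
    -- first `H.1` coordinates only, so the others may be replaced by these values.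
    · have e : (range H'.1).image (fun i => if i < H'.1 then t i else s.v (.y i)) =
          (range H'.1).image t :=
        image_congr fun i hi => if_pos (by simpa using hi)
      have := h₅ (H', fun i => if i < H'.1 then t i else s.v (.y i)) (Or.inr ⟨rfl, Or.inr
        ⟨fun i hi => by dsimp only; rw [if_pos hi]; exact ht i hi,
          fun i hi => if_neg (Nat.not_lt.2 hi)⟩⟩)
        (fun i hi => by dsimp only; rw [if_pos hi]; exact ht i hi)
        (hcopy.congr fun i hi => if_pos hi) (by dsimp only; rw [e]; exact hcore)
      dsimp only at this ⊢
      rwa [e] at this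
    · exact h₅ (H', t) (Or.inl ⟨hb, trivial⟩) ht hcopy hcore

/-! ### Recursion on larger cores -/

namespace Frame

/-- The frame of a recursive call. -/
def push (g : Frame) (c u : ℕ) (W : Finset ℕ) (f : ℕ → ℕ) : Frame :=
  { g with xs := Function.update g.xs c u, W := W, Us := Function.update g.Us c f }

variable {J c u : ℕ} {g : Frame} {W W' U : Finset ℕ} {s : Env} {f : ℕ → ℕ} {ind : Bool}
  {l : List (Σ m : ℕ, SimpleGraph (Fin m))}

theorem core_push : (g.push c u W' f).core (c + 1) = insert u (g.core c) := by
  have : ∀ i ∈ range c, (g.push c u W' f).xs i = g.xs i := fun i hi =>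
    Function.update_of_ne (by have := mem_range.1 hi; omega) _ _
  rw [core, range_add_one, image_insert, image_congr this, core]
  simp [push]

/-- One direction serves to enter the recursive call. The other, applied on return, shows that the
loop variable and the petal array of the caller have survived. -/
theorem lev_push : (g.push c u W' f).Lev J (c + 1) W s ↔
    g.Lev J c W s ∧ s.v (.x c) = u ∧ ∀ v < g.n, s.m (addr g.n J (2 + c) v) = f v := by
  constructor
  · intro h
    refine ⟨⟨h.n, h.k, h.q, h.nn, h.adj, h.row, fun i hi => ?_, h.W, fun i hi => ?_⟩, ?_, ?_⟩
    · refine (h.x i (by omega)).trans ?_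
      simp only [push]; rw [Function.update_of_ne (by omega)]
    · have := h.U i (by omega)
      simp only [push] at this; rwa [Function.update_of_ne (by omega)] at this
    · refine (h.x c (by omega)).trans ?_
      simp [push]
    · have := h.U c (by omega)
      simpa [push] using this
  · rintro ⟨h, hx, hU⟩
    refine ⟨h.n, h.k, h.q, h.nn, h.adj, h.row, fun i hi => ?_, h.W, fun i hi => ?_⟩
    · simp only [push]
      rcases Nat.eq_or_lt_of_le (Nat.le_of_lt_succ hi) with rfl | hi
      · simpa using hx
      · rw [Function.update_of_ne (by omega)]; exact h.x i hi
    · simp only [push]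
      rcases Nat.eq_or_lt_of_le (Nat.le_of_lt_succ hi) with rfl | hi
      · simpa using hU
      · rw [Function.update_of_ne (by omega)]; exact h.U i hi

/-- What a call of the marking program at depth `c` with `d` more levels achieves: all sets of the
family which contain the core are covered by the set `W'` of marked vertices. -/
def Marked (J : ℕ) (ind : Bool) (l : List (Σ m : ℕ, SimpleGraph (Fin m))) (d c : ℕ) (g : Frame)
    (s : Env) : Prop :=
  ∃ W', g.W ⊆ W' ∧ W' ⊆ range g.n ∧ g.Lev J c W' s ∧ #W' ≤ #g.W + markBound g.q d ∧
    ∀ S, g.Fam ind l S → g.core c ⊆ S → Covered (g.Fam ind l) g.q W' S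

theorem Fam.card_le {r : ℕ} (hl : ∀ H ∈ l, H.1 ≤ r) {S : Finset ℕ} (h : g.Fam ind l S) :
    #S ≤ r := by
  obtain ⟨H, hH, t, ht, hc, rfl⟩ := h
  rw [hc.card]
  exact hl H hH

end Frame

theorem hoare_clear (J c : ℕ) (hJ : 2 + c < J) :
    Hoare Frame.n (fun g s => g.OK c ∧ g.Lev J c g.W s)
      (forVar (.x c) (storeAt (.cell J (2 + c) (.var (.x c))) (.lit 0)))
      (fun g s => g.OK c ∧ g.Lev J c g.W s ∧ ∀ v < g.n, s.m (addr g.n J (2 + c) v) = 0) := by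
  refine .forVar _ (fun g i s => g.OK c ∧ g.Lev J c g.W s ∧
    ∀ v < i, s.m (addr g.n J (2 + c) v) = 0) (fun g i s h => h.2.1.n) ?_ (.storeAt _ _ ?_)
    fun g s h => h
  · rintro g s ⟨hg, h⟩
    exact ⟨hg, h.set (Or.inr (Or.inr ⟨c, le_rfl, rfl⟩)) _, by omega⟩
  · rintro ⟨g, i⟩ s ⟨hi, hx, hg, h, h0⟩
    dsimp only at hi hx hg h h0
    rw [h.eval_cell]
    simp only [Expr.eval, hx]
    refine ⟨by simpa using hx, hg, (h.put le_rfl hJ _ _).set (Or.inr (Or.inr ⟨c, le_rfl, rfl⟩)) _,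
      fun v hv => ?_⟩
    rw [Env.set_m, Env.put_m]
    split_ifs with hne
    · rfl
    · exact h0 v (by rw [addr_inj hJ hJ] at hne; omega)

/-- A set around the core that meets `U` in `u` contains the core enlarged by `u`, so the recursive
call for `u` covers it; by `Covered.mono` later marking does no harm. Each element of `U` costs at
most `markBound q d` new marks. -/
theorem hoare_markLoop {J c d : ℕ} (ind : Bool)
    (l : List (Σ m : ℕ, SimpleGraph (Fin m)))
    (ih : Hoare Frame.n (fun g s => g.OK (c + 1) ∧ g.Lev J (c + 1) g.W s)
      (markProg J ind l d (c + 1)) (Frame.Marked J ind l d (c + 1))) :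
    Hoare (fun b : Frame × Finset ℕ => b.1.n)
      (fun b s => b.1.OK c ∧ Disjoint (b.1.core c) b.2 ∧ b.2 ⊆ range b.1.n ∧
        b.1.Lev J c (b.1.W ∪ b.2) s ∧ ∀ v < b.1.n, s.m (addr b.1.n J (2 + c) v) ≠ 0 ↔ v ∈ b.2)
      (forVar (.x c) (whenNonzero (.ld (.cell J (2 + c) (.var (.x c))))
        (markProg J ind l d (c + 1))))
      (fun b s => ∃ W', b.1.W ∪ b.2 ⊆ W' ∧ W' ⊆ range b.1.n ∧ b.1.Lev J c W' s ∧
        #W' ≤ #(b.1.W ∪ b.2) + #b.2 * markBound b.1.q d ∧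
        ∀ S, b.1.Fam ind l S → b.1.core c ⊆ S → ¬ Disjoint S b.2 →
          Covered (b.1.Fam ind l) b.1.q W' S) := by
  refine .forVar _ (fun b i s => b.1.OK c ∧ Disjoint (b.1.core c) b.2 ∧ b.2 ⊆ range b.1.n ∧
    (∀ v < b.1.n, s.m (addr b.1.n J (2 + c) v) ≠ 0 ↔ v ∈ b.2) ∧
    ∃ W', b.1.W ∪ b.2 ⊆ W' ∧ W' ⊆ range b.1.n ∧ b.1.Lev J c W' s ∧
      #W' ≤ #(b.1.W ∪ b.2) + #(b.2.filter (· < i)) * markBound b.1.q d ∧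
      ∀ S, b.1.Fam ind l S → b.1.core c ⊆ S → (∃ u ∈ b.2, u < i ∧ u ∈ S) →
        Covered (b.1.Fam ind l) b.1.q W' S) ?_ ?_ (.whenNonzero _ (ih.conseq ?_) ?_) ?_
  · rintro b i s ⟨-, -, -, -, W', -, -, h, -⟩
    exact h.n
  · rintro ⟨g, U⟩ s ⟨hg, hd, hU, h, harr⟩
    exact ⟨hg, hd, hU, harr, g.W ∪ U, subset_rfl, union_subset hg.marked hU,
      h.set (Or.inr (Or.inr ⟨c, le_rfl, rfl⟩)) _, Nat.le_add_right _ _, by simp⟩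
  · rintro ⟨⟨g, U⟩, i⟩ s ⟨⟨hi, hx, hg, hd, hU, harr, W', hW, hWn, h, hcard, hcov⟩, hne⟩
    dsimp only at hi hx hg hd hU harr hW hWn h hcard hcov
    rw [Expr.eval, h.eval_cell, Expr.eval, hx, harr i hi] at hne
    refine ⟨g.push c i W' fun v => s.m (addr g.n J (2 + c) v), rfl, ⟨⟨?_, hWn, ?_⟩,
      Frame.lev_push.2 ⟨h, hx, fun _ _ => rfl⟩⟩, ?_⟩
    · rw [Frame.core_push]
      exact insert_subset (hW (mem_union_right _ hne))
        ((hg.core.trans subset_union_left).trans hW)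
    · rw [Frame.core_push, card_insert_of_notMem (disjoint_right.1 hd hne), hg.card]
    · rintro s' ⟨W'', hW'', hWn'', h', hcard', hcov'⟩
      obtain ⟨h', hx', harr'⟩ := Frame.lev_push.1 h'
      refine ⟨hx', hg, hd, hU, fun v hv => ?_, W'', hW.trans hW'', hWn'',
        h'.set (Or.inr (Or.inr ⟨c, le_rfl, rfl⟩)) _, ?_, fun S hS hC hu => ?_⟩
      · rw [Env.set_m, harr' v hv, harr v hv]
      · have e : U.filter (· < i + 1) = insert i (U.filter (· < i)) := by
          ext v; simp only [mem_filter, mem_insert]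
          constructor
          · rintro ⟨h₁, h₂⟩
            rcases Nat.eq_or_lt_of_le (Nat.le_of_lt_succ h₂) with h₃ | h₃
            · exact Or.inl h₃
            · exact Or.inr ⟨h₁, h₃⟩
          · rintro (rfl | ⟨h₁, h₂⟩)
            · exact ⟨hne, by omega⟩
            · exact ⟨h₁, by omega⟩
        dsimp only
        rw [e, card_insert_of_notMem (by simp), Nat.succ_mul]
        refine hcard'.trans ?_
        change #W' + markBound g.q d ≤ _
        omega
      · by_cases hiS : i ∈ S
        · exact hcov' S hS (Frame.core_push ▸ insert_subset hiS hC)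
        · obtain ⟨u, hu, hui, huS⟩ := hu
          have : u ≠ i := fun h => hiS (h ▸ huS)
          exact (hcov S hS hC ⟨u, hu, by omega, huS⟩).mono hW''
  · rintro ⟨⟨g, U⟩, i⟩ s ⟨hi, hx, hg, hd, hU, harr, W', hW, hWn, h, hcard, hcov⟩ h0
    dsimp only at hi hx hg hd hU harr hW hWn h hcard hcov
    rw [Expr.eval, h.eval_cell, Expr.eval, hx] at h0
    have hiU : i ∉ U := fun h' => (harr i hi).2 h' h0
    refine ⟨hx, hg, hd, hU, harr, W', hW, hWn, h.set (Or.inr (Or.inr ⟨c, le_rfl, rfl⟩)) _, ?_,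
      fun S hS hC hu => ?_⟩
    · refine hcard.trans (Nat.add_le_add_left (Nat.mul_le_mul_right _ (card_le_card ?_)) _)
      exact monotone_filter_right _ fun v _ hv => Nat.lt_succ_of_lt hv
    · obtain ⟨u, hu, hui, huS⟩ := hu
      have : u ≠ i := fun h => hiU (h ▸ hu)
      exact hcov S hS hC ⟨u, hu, by omega, huS⟩
  · rintro ⟨g, U⟩ s ⟨hg, hd, hU, harr, W', hW, hWn, h, hcard, hcov⟩
    refine ⟨W', hW, hWn, h, hcard.trans (Nat.add_le_add_left (Nat.mul_le_mul_right _
      (card_le_card (filter_subset _ _))) _), fun S hS hC hu => hcov S hS hC ?_⟩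
    obtain ⟨u, hu, huU⟩ := not_disjoint_iff.1 hu
    exact ⟨u, huU, mem_range.1 (hU huU), hu⟩

/-- What is known after the search for petals. -/
theorem Frame.PetalInv.petals {J r c d : ℕ} {ind : Bool}
    {l : List (Σ m : ℕ, SimpleGraph (Fin m))} (hl : ∀ H ∈ l, H.1 ≤ r) (hdc : c + (d + 1) = r)
    {g : Frame} {s : Env}
    (h : g.PetalInv J ind l c ((∅ ∪ {H | H ∈ l.filter fun H => c < H.1}) ×ˢ Set.univ) s) :
    g.OK c ∧ ∃ U P, g.Search J c (g.W ∪ U) U #P s ∧ Flower (g.Fam ind l) (g.core c) P U ∧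
      #P ≤ g.q ∧ U ⊆ range g.n ∧ #U ≤ (d + 1) * g.q ∧ ∀ S, g.Fam ind l S → g.core c ⊆ S →
        S ⊆ g.W ∨ #P = g.q ∨ #P < g.q ∧ ¬ Disjoint S U := by
  obtain ⟨hg, U, P, hS, hF, hq, hU, hD⟩ := h
  refine ⟨hg, U, P, hS, hF, hq, hU, ?_, fun S hS' hC => ?_⟩
  -- A petal has at most `r = c + (d + 1)` vertices, and `c` of them form the core.
  · refine (hF.card_le (d := d + 1) fun B hB => ?_).trans ?_
    · rw [hg.card]; exact (hB.card_le hl).trans hdc.ge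
    · rw [Nat.mul_comm]; exact Nat.mul_le_mul_left _ hq
  · by_cases h : g.core c = S
    · exact Or.inl (h ▸ hg.core)
    · have hss : g.core c ⊂ S := Finset.ssubset_iff_subset_ne.2 ⟨hC, h⟩
      obtain ⟨H, hH, t, ht, hcopy, rfl⟩ := hS'
      have hcard := card_lt_card hss
      rw [hcopy.card, hg.card] at hcard
      have := hD (H, t) ⟨Or.inr (List.mem_filter.2 ⟨hH, by simpa using hcard⟩), trivial⟩ ht hcopy
        hss
      dsimp only at this
      by_cases hP : #P = g.q
      · exact Or.inr (Or.inl hP)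
      · exact Or.inr (Or.inr ⟨lt_of_le_of_ne hq hP, this.resolve_left hP⟩)

/-- The induction is on the number `d = r - c` of vertices that a set of the family can have outside
the core. -/
theorem hoare_mark {J r : ℕ} (hJ : r + 2 ≤ J) (ind : Bool)
    {l : List (Σ m : ℕ, SimpleGraph (Fin m))} (hl : ∀ H ∈ l, H.1 ≤ r) (d c : ℕ) (hdc : c + d = r) :
    Hoare Frame.n (fun g s => g.OK c ∧ g.Lev J c g.W s) (markProg J ind l d c)
      (Frame.Marked J ind l d c) := by
  induction d generalizing c with
  | zero =>
    refine .skip ?_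
    rintro g s ⟨hg, h⟩
    refine ⟨g.W, subset_rfl, hg.marked, h, by simp [markBound], fun S hS hC => Or.inl ?_⟩
    -- The core already has `r` vertices, so a set of the family that contains it is equal to it.
    rw [← eq_of_subset_of_card_le hC (by rw [hg.card]; exact (hS.card_le hl).trans hdc.ge)]
    exact hg.core
  | succ d ih =>
    have hJ' : 2 + c < J := by omega
    refine (hoare_clear J c hJ').seq (.seq (mid := Frame.PetalInv J ind l c (∅ ×ˢ Set.univ))
      (.assign _ _ ?_) (.seq (.seqList _ (fun D => Frame.PetalInv J ind l c (D ×ˢ Set.univ)) _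
        (fun H hH D => ?_) ∅) (.whenNonzero _ ((hoare_markLoop ind l
          (ih (c + 1) (by omega))).conseq ?_) ?_)))
    · rintro g s ⟨hg, h, h0⟩
      refine ⟨hg, ∅, ∅, ⟨?_, by simpa using h0, by simp⟩, .empty, by simp, by simp, by simp⟩
      rw [union_empty]
      exact h.set (Or.inr (Or.inl ⟨c, rfl⟩)) _
    · rw [List.mem_filter, decide_eq_true_iff] at hH
      exact hoare_tryTuples hJ' ind hH.1 hH.2 D
    · rintro g s ⟨hg, hne⟩
      obtain ⟨hg, U, P, hS, hF, hq, hU, hcard, hD⟩ := hg.petals hl hdc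
      simp only [Expr.eval, hS.num, hS.lev.q] at hne
      refine ⟨(g, U), rfl, ⟨hg, hF.disjoint, hU, hS.lev, hS.arr⟩, ?_⟩
      rintro s' ⟨W', hW, hWn, h, hcard', hcov⟩
      dsimp only at hW hWn h hcard' hcov
      refine ⟨W', subset_union_left.trans hW, hWn, h, ?_, fun S hS hC => ?_⟩
      · have h₁ := card_union_le g.W U
        have h₂ := Nat.mul_le_mul_right (1 + markBound g.q d) hcard
        rw [Nat.mul_add, Nat.mul_one] at h₂
        rw [markBound]
        omega
      · rcases hD S hS hC with h' | h' | h'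
        · exact Or.inl ((h'.trans subset_union_left).trans hW)
        · omega
        · exact hcov S hS hC h'.2
    -- Here the flower has all `q` petals: it covers every set properly containing the core, and no
    -- recursion is needed.
    · rintro g s hg h0
      obtain ⟨hg, U, P, hS, hF, hq, hU, hcard, hD⟩ := hg.petals hl hdc
      simp only [Expr.eval, hS.num, hS.lev.q] at h0
      refine ⟨g.W ∪ U, subset_union_left, union_subset hg.marked hU, hS.lev, ?_, fun S hS' hC => ?_⟩
      · refine (card_union_le _ _).trans (Nat.add_le_add_left (hcard.trans ?_) _)
        rw [markBound]
        exact Nat.le_mul_of_pos_right _ (by omega)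
      · by_cases h : g.core c = S
        · exact Or.inl ((h ▸ hg.core).trans subset_union_left)
        · exact Or.inr ⟨_, Finset.ssubset_iff_subset_ne.2 ⟨hC, h⟩, P, U, hF, by omega, fun B hB =>
            (hF.subset hB).trans (union_subset_union_left hg.core)⟩

/-! ### Initialization -/

/-- Compute `q = r * k`, `nn = n * n` and the array of row offsets. -/
def initProg (J r : ℕ) : RAMProg :=
  .seq (assign .q (.smul r (.var .k)))
    (.seq (forVar .i (assign .nn (.add (.var .nn) (.var .n))))
      (forVar .i (.seq (storeAt (.cell J 1 (.var .i)) (.var .out))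
        (assign .out (.add (.var .out) (.var .n))))))

/-- The initial state. -/
structure Frame.Start (g : Frame) (s : Env) : Prop where
  n : s.v .n = g.n
  k : s.v .k = g.k
  zero : ∀ z, z ≠ .n → z ≠ .k → s.v z = 0
  adj : ∀ u < g.n, ∀ v < g.n, s.m (u * g.n + v) = g.A u v
  mem : ∀ a, g.n * g.n ≤ a → s.m a = 0

theorem hoare_init {J r : ℕ} (hJ : 2 ≤ J) :
    Hoare Frame.n (fun g s => g.Start s ∧ g.q = r * g.k ∧ g.W = ∅) (initProg J r)
      (fun g s => g.OK 0 ∧ g.Lev J 0 g.W s) := by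
  refine .seq (mid := fun g s => s.v .n = g.n ∧ s.v .k = g.k ∧ s.v .q = g.q ∧ s.v .nn = 0 ∧
    s.v .out = 0 ∧ (∀ u < g.n, ∀ v < g.n, s.m (u * g.n + v) = g.A u v) ∧
    (∀ a, g.n * g.n ≤ a → s.m a = 0) ∧ g.W = ∅) (.assign _ _ ?_)
    (.seq (mid := fun g s => s.v .n = g.n ∧ s.v .k = g.k ∧ s.v .q = g.q ∧ s.v .nn = g.n * g.n ∧
      s.v .out = 0 ∧ (∀ u < g.n, ∀ v < g.n, s.m (u * g.n + v) = g.A u v) ∧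
      (∀ a, g.n * g.n ≤ a → s.m a = 0) ∧ g.W = ∅)
      (.forVar _ (fun g i s => s.v .n = g.n ∧ s.v .k = g.k ∧ s.v .q = g.q ∧ s.v .nn = i * g.n ∧
        s.v .out = 0 ∧ (∀ u < g.n, ∀ v < g.n, s.m (u * g.n + v) = g.A u v) ∧
        (∀ a, g.n * g.n ≤ a → s.m a = 0) ∧ g.W = ∅) (fun g i s h => h.1) ?_ (.assign _ _ ?_)
        fun g s h => h)
      (.forVar _ (fun g i s => s.v .n = g.n ∧ s.v .k = g.k ∧ s.v .q = g.q ∧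
        s.v .nn = g.n * g.n ∧ s.v .out = i * g.n ∧
        (∀ u < g.n, ∀ v < g.n, s.m (u * g.n + v) = g.A u v) ∧
        (∀ v, s.m (addr g.n J 0 v) = 0) ∧ (∀ u < i, s.m (addr g.n J 1 u) = u * g.n) ∧ g.W = ∅)
        (fun g i s h => h.1) ?_
        (.seq (mid := fun b s => b.2 < b.1.n ∧ s.v .i = b.2 ∧ s.v .n = b.1.n ∧ s.v .k = b.1.k ∧
          s.v .q = b.1.q ∧ s.v .nn = b.1.n * b.1.n ∧ s.v .out = b.2 * b.1.n ∧
          (∀ u < b.1.n, ∀ v < b.1.n, s.m (u * b.1.n + v) = b.1.A u v) ∧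
          (∀ v, s.m (addr b.1.n J 0 v) = 0) ∧ (∀ u < b.2 + 1, s.m (addr b.1.n J 1 u) = u * b.1.n) ∧
          b.1.W = ∅) (.storeAt _ _ ?_) (.assign _ _ ?_)) ?_))
  · rintro g s ⟨h, hq, hW⟩
    exact ⟨by simp [h.n], by simp [h.k], by simp [h.k, hq], by simp [h.zero], by simp [h.zero],
      h.adj, h.mem, hW⟩
  · rintro g s ⟨hn, hk, hq, hnn, ho, h⟩
    exact ⟨by simp [hn], by simp [hk], by simp [hq], by simp [hnn], by simp [ho], h⟩
  · rintro ⟨g, i⟩ s ⟨hi, hx, hn, hk, hq, hnn, ho, h⟩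
    dsimp only at hi hx hn hk hq hnn ho h
    exact ⟨by simp [hx], by simp [hn], by simp [hk], by simp [hq],
      by simp [hnn, hn, Nat.succ_mul], by simp [ho], h⟩
  · rintro g s ⟨hn, hk, hq, hnn, ho, hA, hm, hW⟩
    exact ⟨by simp [hn], by simp [hk], by simp [hq], by simp [hnn], by simp [ho], hA,
      fun v => hm _ (by simp [addr]), by simp, hW⟩
  · rintro ⟨g, i⟩ s ⟨hi, hx, hn, hk, hq, hnn, ho, hA, h0, h1, hW⟩
    dsimp only at hi hx hn hk hq hnn ho hA h0 h1 hW
    have e : (Expr.cell J 1 (.var .i)).eval s = addr g.n J 1 i := by simp [Expr.cell, addr, hnn, hx]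
    rw [e]
    refine ⟨hi, hx, hn, hk, hq, hnn, ho, fun u hu v hv => ?_, fun v => ?_, fun u hu => ?_, hW⟩
    · dsimp only at hu hv
      have := index_lt hu hv
      rw [Env.put_m, if_neg (by simp only [addr]; omega), hA u hu v hv]
    · rw [Env.put_m, if_neg (by rw [addr_inj (by omega) (by omega)]; omega), h0]
    · rw [Env.put_m]
      by_cases hui : u = i
      · rw [if_pos (by rw [hui]), hui]; exact ho
      · rw [if_neg (by rw [addr_inj (by omega) (by omega)]; omega)]
        exact h1 u (by dsimp only at hu; omega)
  · rintro ⟨g, i⟩ s ⟨hi, hx, hn, hk, hq, hnn, ho, h⟩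
    dsimp only at hi hx hn hk hq hnn ho h
    exact ⟨by simp [hx], by simp [hn], by simp [hk], by simp [hq], by simp [hnn],
      by simp [ho, hn, Nat.succ_mul], h⟩
  · rintro g s ⟨hn, hk, hq, hnn, ho, hA, h0, h1, hW⟩
    exact ⟨⟨by simp [Frame.core], by simp [hW], by simp [Frame.core]⟩, hn, hk, hq, hnn, hA, h1,
      by simp, fun v _ => by simp [h0, hW], by simp⟩

/-! ### Output of the graph induced by the marked vertices -/

/-- The number of elements of `W` below `u`. -/
def indexIn (W : Finset ℕ) (u : ℕ) : ℕ := #(W.filter (· < u))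

theorem indexIn_zero (W : Finset ℕ) : indexIn W 0 = 0 := by simp [indexIn]

theorem indexIn_mono (W : Finset ℕ) {u v : ℕ} (h : u ≤ v) : indexIn W u ≤ indexIn W v :=
  card_le_card (monotone_filter_right _ fun _ _ hw => lt_of_lt_of_le hw h)

theorem indexIn_le (W : Finset ℕ) (u : ℕ) : indexIn W u ≤ u := by
  refine (card_le_card (t := range u) fun v hv => ?_).trans (card_range u).le
  exact mem_range.2 (mem_filter.1 hv).2

theorem indexIn_succ_of_mem {W : Finset ℕ} {u : ℕ} (h : u ∈ W) :
    indexIn W (u + 1) = indexIn W u + 1 := by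
  have e : W.filter (· < u + 1) = insert u (W.filter (· < u)) := by
    ext v; simp only [mem_filter, mem_insert]
    constructor
    · rintro ⟨h₁, h₂⟩
      rcases Nat.eq_or_lt_of_le (Nat.le_of_lt_succ h₂) with h₃ | h₃
      · exact Or.inl h₃
      · exact Or.inr ⟨h₁, h₃⟩
    · rintro (rfl | ⟨h₁, h₂⟩)
      · exact ⟨h, by omega⟩
      · exact ⟨h₁, by omega⟩
  rw [indexIn, e, card_insert_of_notMem (by simp), indexIn]

theorem indexIn_succ_of_notMem {W : Finset ℕ} {u : ℕ} (h : u ∉ W) :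
    indexIn W (u + 1) = indexIn W u := by
  refine congrArg card (filter_congr fun v hv => ?_)
  have : v ≠ u := fun h' => h (h' ▸ hv)
  omega

theorem indexIn_lt_indexIn {W : Finset ℕ} {u v : ℕ} (hu : u ∈ W) (h : u < v) :
    indexIn W u < indexIn W v := by
  have := indexIn_mono W (Nat.succ_le_of_lt h)
  rw [Nat.succ_eq_add_one, indexIn_succ_of_mem hu] at this
  exact this

theorem indexIn_eq_card {W : Finset ℕ} {n : ℕ} (h : W ⊆ range n) : indexIn W n = #W := by
  rw [indexIn, filter_true_of_mem fun v hv => mem_range.1 (h hv)]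

theorem indexIn_lt_card {W : Finset ℕ} {n u : ℕ} (h : W ⊆ range n) (hu : u ∈ W) :
    indexIn W u < #W :=
  indexIn_eq_card h ▸ indexIn_lt_indexIn hu (mem_range.1 (h hu))

/-- Write the adjacency matrix of the graph induced by the marked vertices, row by row, to the
beginning of the memory, and replace the number of vertices. -/
def outputProg (J : ℕ) : RAMProg :=
  .seq (assign .out (.lit 0))
    (.seq (assign .cnt (.lit 0))
      (.seq (forVar .i (whenNonzero (.ld (.cell J 0 (.var .i)))
          (.seq (assign .cnt (.add (.var .cnt) (.lit 1)))
            (forVar .j (whenNonzero (.ld (.cell J 0 (.var .j)))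
              (.seq (storeAt (.var .out) (.adj J .i .j))
                (assign .out (.add (.var .out) (.lit 1)))))))))
        (assign .n (.var .cnt))))

/-- The pairs of vertices before `(i, j)` have been processed. -/
structure OutInv (J : ℕ) (g : Frame) (W : Finset ℕ) (i j : ℕ) (s : Env) : Prop where
  n : s.v .n = g.n
  k : s.v .k = g.k
  nn : s.v .nn = g.n * g.n
  sub : W ⊆ range g.n
  row : ∀ u < g.n, s.m (addr g.n J 1 u) = u * g.n
  arr : ∀ v < g.n, s.m (addr g.n J 0 v) ≠ 0 ↔ v ∈ W
  done : ∀ u ∈ W, ∀ v ∈ W, u < i ∨ u = i ∧ v < j → s.m (indexIn W u * #W + indexIn W v) = g.A u v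
  todo : ∀ u < g.n, ∀ v < g.n, i < u ∨ u = i ∧ j ≤ v → s.m (u * g.n + v) = g.A u v

namespace OutInv

variable {J : ℕ} {g : Frame} {W : Finset ℕ} {i j : ℕ} {s : Env}

theorem set (h : OutInv J g W i j s) {z : Var} (hz : z = .i ∨ z = .j ∨ z = .out ∨ z = .cnt)
    (e : ℕ) : OutInv J g W i j (s.set z e) := by
  have hz' : Var.n ≠ z ∧ Var.k ≠ z ∧ Var.nn ≠ z := by
    rcases hz with rfl | rfl | rfl | rfl <;> simp
  exact ⟨by simp [hz', h.n], by simp [hz', h.k], by simp [hz', h.nn], h.sub, h.row, h.arr, h.done,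
    h.todo⟩

theorem eval_cell (h : OutInv J g W i j s) (a : ℕ) (e : Expr) :
    (Expr.cell J a e).eval s = addr g.n J a (e.eval s) := by
  simp [Expr.cell, addr, h.nn]

theorem nextRow (h : OutInv J g W i g.n s) : OutInv J g W (i + 1) 0 s := by
  refine ⟨h.n, h.k, h.nn, h.sub, h.row, h.arr, fun u hu v hv huv => h.done u hu v hv ?_,
    fun u hu v hv huv => h.todo u hu v hv (by omega)⟩
  have := mem_range.1 (h.sub hv)
  omega

theorem skipRow (h : OutInv J g W i 0 s) (hi : i ∉ W) : OutInv J g W (i + 1) 0 s := by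
  refine ⟨h.n, h.k, h.nn, h.sub, h.row, h.arr, fun u hu v hv huv => h.done u hu v hv ?_,
    fun u hu v hv huv => h.todo u hu v hv (by omega)⟩
  have : u ≠ i := fun h' => hi (h' ▸ hu)
  omega

theorem skipEntry (h : OutInv J g W i j s) (hj : j ∉ W) : OutInv J g W i (j + 1) s := by
  refine ⟨h.n, h.k, h.nn, h.sub, h.row, h.arr, fun u hu v hv huv => h.done u hu v hv ?_,
    fun u hu v hv huv => h.todo u hu v hv (by omega)⟩
  have : v ≠ j := fun h' => hj (h' ▸ hv)
  omega

/-- The small matrix is written over the large one. This is safe because ranks in `W` do not exceed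
the vertices themselves and `#W ≤ n`: the write position never gets ahead of the entry being read.
-/
theorem put (h : OutInv J g W i j s) (hi : i ∈ W) (hj : j ∈ W) :
    OutInv J g W i (j + 1) (s.put (indexIn W i * #W + indexIn W j) (g.A i j)) := by
  have hin := mem_range.1 (h.sub hi)
  have hjn := mem_range.1 (h.sub hj)
  have hle : indexIn W i * #W + indexIn W j ≤ i * g.n + j := by
    refine Nat.add_le_add (Nat.mul_le_mul (indexIn_le W i) ?_) (indexIn_le W j)
    simpa using card_le_card h.sub
  have hlt := index_lt hin hjn
  refine ⟨h.n, h.k, h.nn, h.sub, fun u hu => ?_, fun u hu => ?_, fun u hu v hv huv => ?_,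
    fun u hu v hv huv => ?_⟩
  · rw [Env.put_m, if_neg (by simp only [addr]; omega), h.row u hu]
  · rw [Env.put_m, if_neg (by simp only [addr]; omega), h.arr u hu]
  · rw [Env.put_m]
    have hv' := indexIn_lt_card h.sub hv
    have row : u < i → indexIn W u * #W + #W ≤ indexIn W i * #W := fun hui => by
      rw [← Nat.succ_mul]; exact Nat.mul_le_mul_right _ (indexIn_lt_indexIn hu hui)
    by_cases huv' : u = i ∧ v = j
    · rw [huv'.1, huv'.2, if_pos rfl]
    · have huv'' : u < i ∨ u = i ∧ v < j := by omega
      rw [if_neg, h.done u hu v hv huv'']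
      -- Positions in the small matrix strictly increase in row-major order, so no finished entry is
      -- overwritten.
      rcases huv'' with h' | ⟨rfl, h'⟩
      · have := row h'; omega
      · have := indexIn_lt_indexIn hv h'; omega
  · have : i * g.n + j < u * g.n + v := by
      rcases huv with h' | ⟨rfl, h'⟩
      · have := Nat.mul_le_mul_right g.n (Nat.succ_le_of_lt h')
        rw [Nat.succ_mul] at this; omega
      · omega
    rw [Env.put_m, if_neg (by omega), h.todo u hu v hv (by omega)]

end OutInv

theorem hoare_output (J : ℕ) :
    Hoare (fun b : Frame × Finset ℕ => b.1.n) (fun b s => b.1.Lev J 0 b.2 s ∧ b.2 ⊆ range b.1.n)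
      (outputProg J)
      (fun b s => s.v .n = #b.2 ∧ s.v .k = b.1.k ∧ ∀ u ∈ b.2, ∀ v ∈ b.2,
        s.m (indexIn b.2 u * #b.2 + indexIn b.2 v) = b.1.A u v) := by
  refine .seq (mid := fun b s => (b.1.Lev J 0 b.2 s ∧ b.2 ⊆ range b.1.n) ∧ s.v .out = 0)
    (.assign _ _ ?_) (.seq (mid := fun b s => OutInv J b.1 b.2 0 0 s ∧ s.v .out = 0 ∧ s.v .cnt = 0)
    (.assign _ _ ?_) (.seq (mid := fun b s => OutInv J b.1 b.2 b.1.n 0 s ∧ s.v .cnt = #b.2)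
    (.forVar _ (fun b i s => OutInv J b.1 b.2 i 0 s ∧ s.v .out = indexIn b.2 i * #b.2 ∧
      s.v .cnt = indexIn b.2 i) (fun b i s h => h.1.n) ?_ (.whenNonzero _ (.seq
        (mid := fun b s => b.2 ∈ b.1.2 ∧ OutInv J b.1.1 b.1.2 b.2 0 s ∧ s.v .i = b.2 ∧
          s.v .out = indexIn b.1.2 b.2 * #b.1.2 ∧ s.v .cnt = indexIn b.1.2 b.2 + 1) (.assign _ _ ?_)
        (.forVar _ (fun b j s => b.2 ∈ b.1.2 ∧ OutInv J b.1.1 b.1.2 b.2 j s ∧ s.v .i = b.2 ∧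
          s.v .out = indexIn b.1.2 b.2 * #b.1.2 + indexIn b.1.2 j ∧
          s.v .cnt = indexIn b.1.2 b.2 + 1)
          (fun b i s h => h.2.1.n) ?_ (.whenNonzero _ (.seq (mid := fun b s =>
            b.1.2 ∈ b.1.1.2 ∧ b.2 ∈ b.1.1.2 ∧ OutInv J b.1.1.1 b.1.1.2 b.1.2 (b.2 + 1) s ∧
            s.v .i = b.1.2 ∧ s.v .j = b.2 ∧
            s.v .out = indexIn b.1.1.2 b.1.2 * #b.1.1.2 + indexIn b.1.1.2 b.2 ∧
            s.v .cnt = indexIn b.1.1.2 b.1.2 + 1) (.storeAt _ _ ?_)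
          (.assign _ _ ?_)) ?_) ?_)) ?_) ?_)
    (.assign _ _ ?_)))
  · rintro ⟨g, W⟩ s ⟨h, hW⟩
    exact ⟨⟨⟨by simp [h.n], by simp [h.k], by simp [h.q], by simp [h.nn], h.adj, h.row, by simp,
      h.W, by simp⟩, hW⟩, by simp⟩
  · rintro ⟨g, W⟩ s ⟨⟨h, hW⟩, ho⟩
    exact ⟨⟨by simp [h.n], by simp [h.k], by simp [h.nn], hW, h.row, h.W, by simp,
      fun u hu v hv _ => h.adj u hu v hv⟩, by simpa using ho, by simp⟩
  · rintro ⟨g, W⟩ s ⟨h, ho, hc⟩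
    exact ⟨h.set (by simp) _, by simpa [indexIn_zero] using ho, by simpa [indexIn_zero] using hc⟩
  · rintro ⟨⟨g, W⟩, i⟩ s ⟨⟨hi, hx, h, ho, hc⟩, hne⟩
    dsimp only at hi hx h ho hc
    rw [Expr.eval, h.eval_cell, Expr.eval, hx, h.arr i hi] at hne
    exact ⟨hne, h.set (by simp) _, by simpa using hx, by simpa using ho, by simpa using hc⟩
  · rintro ⟨⟨g, W⟩, i⟩ s ⟨hi, h, hx, ho, hc⟩
    exact ⟨hi, h.set (by simp) _, by simpa using hx, by simpa [indexIn_zero] using ho,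
      by simpa using hc⟩
  · rintro ⟨⟨⟨g, W⟩, i⟩, j⟩ s ⟨⟨hj, hy, hi, h, hx, ho, hc⟩, hne⟩
    dsimp only at hj hy hi h hx ho hc
    rw [Expr.eval, h.eval_cell, Expr.eval, hy, h.arr j hj] at hne
    have e : (Expr.adj J .i .j).eval s = g.A i j := by
      have hin := mem_range.1 (h.sub hi)
      simp only [Expr.adj, Expr.eval, h.eval_cell, hx, hy, h.row i hin,
        h.todo i hin j hj (by omega)]
    rw [e]
    simp only [Expr.eval, ho]
    exact ⟨hi, hne, h.put hi hne, hx, hy, ho, hc⟩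
  · rintro ⟨⟨⟨g, W⟩, i⟩, j⟩ s ⟨hi, hj, h, hx, hy, ho, hc⟩
    dsimp only at hi hj h hx hy ho hc
    exact ⟨by simpa using hy, hi, (h.set (by simp) _).set (by simp) _, by simpa using hx,
      by simp [ho, indexIn_succ_of_mem hj, Nat.add_assoc], by simpa using hc⟩
  · rintro ⟨⟨⟨g, W⟩, i⟩, j⟩ s ⟨hj, hy, hi, h, hx, ho, hc⟩ h0
    dsimp only at hj hy hi h hx ho hc
    rw [Expr.eval, h.eval_cell, Expr.eval, hy] at h0
    have hjW : j ∉ W := fun h' => (h.arr j hj).2 h' h0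
    exact ⟨hy, hi, (h.skipEntry hjW).set (by simp) _, by simpa using hx,
      by simp [ho, indexIn_succ_of_notMem hjW], by simpa using hc⟩
  · rintro ⟨⟨g, W⟩, i⟩ s ⟨hi, h, hx, ho, hc⟩
    dsimp only at hi h hx ho hc
    refine ⟨hx, h.nextRow.set (by simp) _, ?_, by simp [hc, indexIn_succ_of_mem hi]⟩
    simp [ho, indexIn_succ_of_mem hi, indexIn_eq_card h.sub, Nat.succ_mul]
  · rintro ⟨⟨g, W⟩, i⟩ s ⟨hi, hx, h, ho, hc⟩ h0
    dsimp only at hi hx h ho hc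
    rw [Expr.eval, h.eval_cell, Expr.eval, hx] at h0
    have hiW : i ∉ W := fun h' => (h.arr i hi).2 h' h0
    exact ⟨hx, (h.skipRow hiW).set (by simp) _, by simp [ho, indexIn_succ_of_notMem hiW],
      by simp [hc, indexIn_succ_of_notMem hiW]⟩
  · rintro ⟨g, W⟩ s ⟨h, ho, hc⟩
    exact ⟨h, hc.trans (indexIn_eq_card h.sub)⟩
  · rintro ⟨g, W⟩ s ⟨h, hc⟩
    exact ⟨by simp [hc], by simp [h.k], fun u hu v hv =>
      h.done u hu v hv (Or.inl (mem_range.1 (h.sub hu)))⟩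

/-! ### Moving a packing into the set of marked vertices -/

section Replacement

variable {X V : Type} [DecidableEq X] [DecidableEq V]

/-- Among the petals of a flower with many petals, one avoids a given small set. -/
theorem Flower.exists_disjoint {F : Finset V → Prop} {C U Y : Finset V} {P : Finset (Finset V)}
    (h : Flower F C P U) (hY : #Y < #P) : ∃ B ∈ P, Disjoint (B \ C) Y := by
  by_contra! hcon
  have : ∀ B : P, ∃ y ∈ Y, y ∈ B.1 \ C := fun B => by
    obtain ⟨y, hy, hy'⟩ := not_disjoint_iff.1 (hcon B.1 B.2)
    exact ⟨y, hy', hy⟩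
  choose y hy hy' using this
  -- A vertex outside the core lies in at most one petal. If every petal met `Y` outside the core,
  -- this would inject the petals into `Y`.
  have hinj : Function.Injective fun B : P => (⟨y B, hy B⟩ : Y) := by
    intro B B' hBB'
    have e : y B = y B' := congrArg Subtype.val hBB'
    by_contra hne
    have h₁ := mem_sdiff.1 (hy' B)
    have h₂ := mem_sdiff.1 (hy' B')
    exact h₁.2 (h.disj B.1 B.2 B'.1 B'.2 (fun h => hne (Subtype.ext h))
      (mem_inter.2 ⟨h₁.1, e ▸ h₂.1⟩))
  have := Fintype.card_le_of_injective _ hinj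
  simp only [Fintype.card_coe] at this
  omega

/-- If all sets of the family are covered by `W`, with flowers of at least `r * k` petals, then a
packing of `k` objects can be moved into `W`. -/
theorem exists_packing_subset (vs : X → Finset V) (good : X → Prop) (distinct : Prop) {r t k : ℕ}
    (hr : 1 ≤ r) (ht : 1 ≤ t) (hcard : ∀ A, good A → #(vs A) ≤ r) {F : Finset V → Prop}
    (hF : ∀ S, F S ↔ ∃ A, good A ∧ vs A = S) {W : Finset V}
    (hW : ∀ S, F S → Covered F (r * k) W S) (K : Finset X) (hk : #K = k) (hgood : ∀ A ∈ K, good A)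
    (hdist : distinct → ∀ A ∈ K, ∀ B ∈ K, A ≠ B → vs A ≠ vs B)
    (hmem : ∀ v, #(K.filter fun A => v ∈ vs A) ≤ t) :
    ∃ K' : Finset X, #K' = k ∧ (∀ A ∈ K', good A ∧ vs A ⊆ W) ∧
      (distinct → ∀ A ∈ K', ∀ B ∈ K', A ≠ B → vs A ≠ vs B) ∧
      ∀ v, #(K'.filter fun A => v ∈ vs A) ≤ t := by
  -- Each exchange replaces a member that leaves `W` by one inside `W`, so the number of members to
  -- be moved drops.
  induction hd : #(K.filter fun A => ¬ vs A ⊆ W) using Nat.strong_induction_on generalizing K with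
  | _ d ih =>
  by_cases hall : ∀ A ∈ K, vs A ⊆ W
  · exact ⟨K, hk, fun A hA => ⟨hgood A hA, hall A hA⟩, hdist, hmem⟩
  push Not at hall
  obtain ⟨A, hA, hAW⟩ := hall
  obtain ⟨C, hC, P, U, hP, hPk, hPW⟩ := (hW _ ((hF _).2 ⟨A, hgood A hA, rfl⟩)).resolve_left hAW
  set K₀ := K.erase A with hK₀
  have hK : K = insert A K₀ := (insert_erase hA).symm
  have hAK₀ : A ∉ K₀ := notMem_erase A K
  have hk₀ : #K₀ + 1 = k := by rw [← hk, hK, card_insert_of_notMem hAK₀]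
  have hsub : ∀ {B}, B ∈ K₀ → B ∈ K := fun h => mem_of_mem_erase h
  -- The other `k - 1` members have at most `r * (k - 1)` vertices together, fewer than the `r * k`
  -- petals because `r ≥ 1`.
  have hY : #(K₀.biUnion vs) < #P := by
    refine lt_of_le_of_lt (card_biUnion_le_card_mul _ _ r fun B hB =>
      hcard B (hgood B (hsub hB))) (lt_of_lt_of_le ?_ hPk)
    rw [← hk₀, Nat.mul_comm, Nat.mul_succ]
    omega
  obtain ⟨B, hB, hBY⟩ := hP.exists_disjoint hY
  obtain ⟨⟨hBF, hBC⟩, hBW⟩ := And.intro (hP.mem B hB) (hPW B hB)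
  obtain ⟨A', hA', rfl⟩ := (hF B).1 hBF
  have hnew : ∀ v ∈ vs A', v ∉ C → ∀ D ∈ K₀, v ∉ vs D := fun v hv hvC D hD hvD =>
    disjoint_left.1 hBY (mem_sdiff.2 ⟨hv, hvC⟩) (mem_biUnion.2 ⟨D, hD, hvD⟩)
  have hne : ∀ D ∈ K₀, vs A' ≠ vs D := fun D hD h => by
    obtain ⟨v, hv, hvC⟩ := exists_of_ssubset hBC
    exact hnew v hv hvC D hD (h ▸ hv)
  have hA'K₀ : A' ∉ K₀ := fun h => hne A' h rfl
  refine ih _ ?_ (insert A' K₀) (by rw [card_insert_of_notMem hA'K₀, hk₀]) (fun D hD => ?_)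
    (fun hdis D hD E hE hDE => ?_) (fun v => ?_) rfl
  · rw [← hd, hK, filter_insert, filter_insert, if_neg (by simpa using hBW), if_pos hAW,
      card_insert_of_notMem fun h => hAK₀ (mem_filter.1 h).1]
    omega
  · rcases mem_insert.1 hD with rfl | hD
    · exact hA'
    · exact hgood D (hsub hD)
  · rcases mem_insert.1 hD with rfl | hD' <;> rcases mem_insert.1 hE with rfl | hE'
    · exact absurd rfl hDE
    · exact hne E hE'
    · exact (hne D hD').symm
    · exact hdist hdis D (hsub hD') E (hsub hE') hDE
  · have hle : #(K₀.filter fun A => v ∈ vs A) ≤ #(K.filter fun A => v ∈ vs A) :=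
      card_le_card (filter_subset_filter _ (erase_subset _ _))
    rw [filter_insert]
    split_ifs with hv
    · refine (card_insert_le _ _).trans ?_
      -- A core vertex trades its membership in `A` for one in `A'`. Any other vertex of `A'` lies
      -- in no remaining member, so its count is 1, and `t ≥ 1` suffices.
      by_cases hvC : v ∈ C
      · refine le_trans ?_ (hmem v)
        rw [hK, filter_insert, if_pos (hC.subset hvC),
          card_insert_of_notMem fun h => hAK₀ (mem_filter.1 h).1]
      · rw [filter_false_of_mem fun D hD => hnew v hv hvC D hD]
        simpa using ht
    · exact hle.trans (hmem v)

end Replacement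

/-! ### Subgraphs -/

/-- A common form of the three problems. -/
def Packing (𝓗 : GraphFamily) (t : ℕ) (ind : Bool) (distinct : Prop) {V : Type}
    (G : SimpleGraph V) (k : ℕ) : Prop :=
  ∃ K : Finset G.Subgraph, k ≤ #K ∧
    (∀ A ∈ K, (ind = true → A.IsInduced) ∧ IsFamilySubgraph 𝓗 A) ∧
    (distinct → ∀ A ∈ K, ∀ B ∈ K, A ≠ B → A.verts ≠ B.verts) ∧ BoundedMembership t K

section Map

variable {V V' : Type} {G : SimpleGraph V} {G' : SimpleGraph V'} (f : G' ↪g G)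

theorem Subgraph.map_embedding_injective :
    Function.Injective (SimpleGraph.Subgraph.map f.toHom) := by
  intro A B h
  ext u v
  · have := congrArg (fun A : G.Subgraph => f u ∈ A.verts) h
    simpa [f.injective.eq_iff] using this
  · have := congrArg (fun A : G.Subgraph => A.Adj (f u) (f v)) h
    simpa [Relation.map_apply_apply f.injective f.injective] using this

theorem Subgraph.map_comap_embedding {A : G.Subgraph} (hA : A.verts ⊆ Set.range f) :
    (A.comap f.toHom).map f.toHom = A := by
  ext u v
  · simp only [SimpleGraph.Subgraph.map_verts, SimpleGraph.Subgraph.comap_verts, Set.mem_image,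
      Set.mem_preimage]
    constructor
    · rintro ⟨w, hw, rfl⟩; exact hw
    · intro hu
      obtain ⟨w, rfl⟩ := hA hu
      exact ⟨w, hu, rfl⟩
  · simp only [SimpleGraph.Subgraph.map_adj, Relation.Map, SimpleGraph.Subgraph.comap_adj]
    constructor
    · rintro ⟨a, b, ⟨-, h⟩, rfl, rfl⟩; exact h
    · intro h
      obtain ⟨a, rfl⟩ := hA (A.edge_vert h)
      obtain ⟨b, rfl⟩ := hA (A.edge_vert h.symm)
      exact ⟨a, b, ⟨f.map_adj_iff.1 (A.adj_sub h), h⟩, rfl, rfl⟩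

theorem Subgraph.isInduced_map_embedding {A : G'.Subgraph} :
    (A.map f.toHom).IsInduced ↔ A.IsInduced := by
  constructor
  · intro h u hu v hv huv
    have := h (Set.mem_image_of_mem f hu) (Set.mem_image_of_mem f hv) (f.map_adj_iff.2 huv)
    exact (Relation.map_apply_apply f.injective f.injective _ _ _).1 this
  · rintro h _ ⟨u, hu, rfl⟩ _ ⟨v, hv, rfl⟩ huv
    exact ⟨u, v, h hu hv (f.map_adj_iff.1 huv), rfl, rfl⟩

theorem isFamilySubgraph_map_embedding {𝓗 : GraphFamily} {A : G'.Subgraph} :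
    IsFamilySubgraph 𝓗 (A.map f.toHom) ↔ IsFamilySubgraph 𝓗 A := by
  have e : A.coe ≃g (A.map f.toHom).coe := f.toCopy.isoSubgraphMap A
  exact exists_congr fun H => and_congr_right fun _ => ⟨fun ⟨i⟩ => ⟨e.trans i⟩,
    fun ⟨i⟩ => ⟨e.symm.trans i⟩⟩

/-- A packing in a graph that is embedded in `G`, in terms of subgraphs of `G`. -/
theorem packing_iff_of_embedding (𝓗 : GraphFamily) (t : ℕ) (ind : Bool) (distinct : Prop) (k : ℕ) :
    Packing 𝓗 t ind distinct G' k ↔ ∃ K : Finset G.Subgraph, k ≤ #K ∧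
      (∀ A ∈ K, ((ind = true → A.IsInduced) ∧ IsFamilySubgraph 𝓗 A) ∧ A.verts ⊆ Set.range f) ∧
      (distinct → ∀ A ∈ K, ∀ B ∈ K, A ≠ B → A.verts ≠ B.verts) ∧ BoundedMembership t K := by
  classical
  have hinj := Subgraph.map_embedding_injective f
  have hmem : ∀ (K : Finset G'.Subgraph) (v : V'),
      {A | A ∈ K.image (SimpleGraph.Subgraph.map f.toHom) ∧ f v ∈ A.verts} =
        SimpleGraph.Subgraph.map f.toHom '' {A | A ∈ K ∧ v ∈ A.verts} := by
    intro K v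
    ext A
    simp only [mem_image, Set.mem_ofPred_eq, Set.mem_image]
    constructor
    · rintro ⟨⟨B, hB, rfl⟩, u, hu, huv⟩
      exact ⟨B, ⟨hB, f.injective huv ▸ hu⟩, rfl⟩
    · rintro ⟨B, ⟨hB, hv⟩, rfl⟩
      exact ⟨⟨B, hB, rfl⟩, v, hv, rfl⟩
  have hiff : ∀ K : Finset G'.Subgraph, (k ≤ #K ∧
      (∀ A ∈ K, (ind = true → A.IsInduced) ∧ IsFamilySubgraph 𝓗 A) ∧
      (distinct → ∀ A ∈ K, ∀ B ∈ K, A ≠ B → A.verts ≠ B.verts) ∧ BoundedMembership t K) ↔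
      (k ≤ #(K.image (SimpleGraph.Subgraph.map f.toHom)) ∧
      (∀ A ∈ K.image (SimpleGraph.Subgraph.map f.toHom),
        ((ind = true → A.IsInduced) ∧ IsFamilySubgraph 𝓗 A) ∧ A.verts ⊆ Set.range f) ∧
      (distinct → ∀ A ∈ K.image (SimpleGraph.Subgraph.map f.toHom),
        ∀ B ∈ K.image (SimpleGraph.Subgraph.map f.toHom), A ≠ B → A.verts ≠ B.verts) ∧
      BoundedMembership t (K.image (SimpleGraph.Subgraph.map f.toHom))) := by
    intro K
    rw [card_image_of_injective _ hinj]
    refine and_congr_right fun _ => and_congr ?_ (and_congr ?_ ?_)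
    · rw [forall_mem_image]
      refine forall₂_congr fun A _ => ?_
      rw [Subgraph.isInduced_map_embedding, isFamilySubgraph_map_embedding]
      exact ⟨fun h => ⟨h, Set.image_subset_range _ _⟩, fun h => h.1⟩
    · simp only [forall_mem_image, hinj.ne_iff]
      refine imp_congr_right fun _ => forall₂_congr fun A _ => forall₂_congr fun B _ =>
        imp_congr_right fun _ => ?_
      exact (Set.image_injective.2 f.injective).ne_iff.symm
    · constructor
      · intro h v
        by_cases hv : v ∈ Set.range f
        · obtain ⟨u, rfl⟩ := hv
          rw [hmem, Set.ncard_image_of_injective _ hinj]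
          exact h u
        · have : {A | A ∈ K.image (SimpleGraph.Subgraph.map f.toHom) ∧ v ∈ A.verts} = ∅ := by
            refine Set.eq_empty_of_forall_notMem ?_
            rintro A ⟨hA, hvA⟩
            obtain ⟨B, -, rfl⟩ := mem_image.1 hA
            exact hv (Set.image_subset_range _ _ hvA)
          rw [this, Set.ncard_empty]
          exact Nat.zero_le _
      · intro h v
        have := h (f v)
        rwa [hmem, Set.ncard_image_of_injective _ hinj] at this
  constructor
  · rintro ⟨K, hK⟩
    exact ⟨_, (hiff K).1 hK⟩
  · rintro ⟨K, hK⟩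
    -- Subgraphs with all vertices in the range of `f` are images of their pullbacks, so the packing
    -- comes from one in `G'`.
    have e : (K.image (SimpleGraph.Subgraph.comap f.toHom)).image
        (SimpleGraph.Subgraph.map f.toHom) = K := by
      rw [image_image]
      exact (image_congr fun A hA => Subgraph.map_comap_embedding f (hK.2.1 A hA).2).trans
        image_id
    exact ⟨_, (hiff _).2 (e.symm ▸ hK)⟩

end Map

/-! ### The kernel -/

section Fin

variable {n : ℕ} {G : SimpleGraph (Fin n)}

open Classical in
/-- The adjacency matrix, extended by zeros. -/
noncomputable def adjMatrixNat (G : SimpleGraph (Fin n)) (i j : ℕ) : ℕ :=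
  if ∃ u v : Fin n, G.Adj u v ∧ u.val = i ∧ v.val = j then 1 else 0

theorem adjMatrixNat_eq (u v : Fin n) [Decidable (G.Adj u v)] :
    adjMatrixNat G u v = if G.Adj u v then 1 else 0 := by
  have : (∃ u' v' : Fin n, G.Adj u' v' ∧ u'.val = u.val ∧ v'.val = v.val) ↔ G.Adj u v := by
    refine ⟨?_, fun h => ⟨u, v, h, rfl, rfl⟩⟩
    rintro ⟨u', v', h, hu, hv⟩
    rwa [← Fin.ext hu, ← Fin.ext hv]
  by_cases h : G.Adj u v <;> simp only [adjMatrixNat, this, h, if_true, if_false]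

theorem adjMatrixNat_ne_zero {u v : Fin n} : adjMatrixNat G u v ≠ 0 ↔ G.Adj u v := by
  classical
  rw [adjMatrixNat_eq]; simp

open Classical in
/-- The vertex set of a subgraph, as a set of numbers. -/
noncomputable def vertexSet (A : G.Subgraph) : Finset ℕ :=
  (univ.filter (· ∈ A.verts)).map Fin.valEmbedding

theorem mem_vertexSet {A : G.Subgraph} {v : ℕ} : v ∈ vertexSet A ↔ ∃ u ∈ A.verts, u.val = v := by
  simp [vertexSet]

theorem val_mem_vertexSet {A : G.Subgraph} {v : Fin n} : v.val ∈ vertexSet A ↔ v ∈ A.verts := by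
  simp [mem_vertexSet, Fin.val_inj]

theorem vertexSet_eq_iff {A B : G.Subgraph} : vertexSet A = vertexSet B ↔ A.verts = B.verts := by
  constructor
  · intro h
    ext v
    rw [← val_mem_vertexSet, h, val_mem_vertexSet]
  · intro h
    ext v
    rw [mem_vertexSet, h, mem_vertexSet]

/-- The initial frame of the marking program. -/
noncomputable def initFrame (G : SimpleGraph (Fin n)) (k q : ℕ) : Frame :=
  ⟨n, q, k, adjMatrixNat G, fun _ => 0, ∅, fun _ _ => 0⟩

/-- This links the tuples tested by the program to subgraphs of `G`. Marking deals with vertex sets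
only; several subgraphs may share one, and the exchange needs just one of them. -/
theorem fam_initFrame_iff (𝓗 : GraphFamily) (ind : Bool) (k q : ℕ) (S : Finset ℕ) :
    (initFrame G k q).Fam ind 𝓗.toList S ↔
      ∃ A : G.Subgraph, ((ind = true → A.IsInduced) ∧ IsFamilySubgraph 𝓗 A) ∧ vertexSet A = S := by
  constructor
  · rintro ⟨H, hH, t, ht, hcopy, rfl⟩
    have ht' : ∀ i : Fin H.1, t i < n := fun i => ht i i.2
    let f : SimpleGraph.Copy H.2 G := ⟨⟨fun i => ⟨t i, ht' i⟩, fun {i j} hij =>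
      adjMatrixNat_ne_zero.1 ((hcopy i j hij.ne).2.1 hij)⟩, fun i j hij => by
        by_contra hne
        exact (hcopy i j hne).1 (congrArg Fin.val hij)⟩
    refine ⟨f.toSubgraph, ⟨fun hind => ?_, H, mem_toList.1 hH, ⟨f.isoToSubgraph.symm⟩⟩, ?_⟩
    · rintro _ ⟨i, -, rfl⟩ _ ⟨j, -, rfl⟩ hij
      refine ⟨i, j, ?_, rfl, rfl⟩
      by_contra hH'
      have hne : i ≠ j := fun h => hij.ne (congrArg _ h)
      exact adjMatrixNat_ne_zero.2 hij ((hcopy i j hne).2.2 hH' hind)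
    · ext v
      rw [mem_vertexSet, mem_image]
      constructor
      · rintro ⟨_, ⟨i, -, rfl⟩, rfl⟩
        exact ⟨i, mem_range.2 i.2, rfl⟩
      · rintro ⟨i, hi, rfl⟩
        exact ⟨f ⟨i, mem_range.1 hi⟩, ⟨_, trivial, rfl⟩, rfl⟩
  · rintro ⟨A, ⟨hind, H, hH, ⟨e⟩⟩, rfl⟩
    let t : ℕ → ℕ := fun i => if h : i < H.1 then (e.symm ⟨i, h⟩).1.val else 0
    have ht : ∀ i : Fin H.1, t i = (e.symm i).1.val := fun i => dif_pos i.2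
    refine ⟨H, mem_toList.2 hH, t, fun i hi => (ht ⟨i, hi⟩).trans_lt (Fin.is_lt _),
      fun i j hij => ⟨?_, fun h => ?_, fun h hi => ?_⟩, ?_⟩
    · rw [ht, ht]
      exact fun h => hij (e.symm.injective (Subtype.ext (Fin.ext h)))
    · rw [ht, ht]
      exact adjMatrixNat_ne_zero.2 (A.adj_sub (e.symm.map_adj_iff.2 h))
    · rw [ht, ht]
      by_contra hA
      exact h (e.symm.map_adj_iff.1
        (hind hi (e.symm i).2 (e.symm j).2 (adjMatrixNat_ne_zero.1 hA)))
    · ext v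
      rw [mem_vertexSet, mem_image]
      constructor
      · rintro ⟨u, hu, rfl⟩
        refine ⟨e ⟨u, hu⟩, mem_range.2 (Fin.is_lt _), ?_⟩
        rw [ht, e.symm_apply_apply]
      · rintro ⟨i, hi, rfl⟩
        exact ⟨_, (e.symm ⟨i, mem_range.1 hi⟩).2, (ht ⟨i, mem_range.1 hi⟩).symm⟩

theorem boundedMembership_iff {t : ℕ} {K : Finset G.Subgraph} :
    BoundedMembership t K ↔ ∀ v, #(K.filter fun A => v ∈ vertexSet A) ≤ t := by
  classical
  have key : ∀ v : Fin n, {A : G.Subgraph | A ∈ K ∧ v ∈ A.verts}.ncard =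
      #(K.filter fun A => v.val ∈ vertexSet A) := fun v => by
    rw [← Set.ncard_coe_finset]
    congr 1
    ext A
    simp [val_mem_vertexSet]
  constructor
  · intro h v
    by_cases hv : v < n
    · exact (key ⟨v, hv⟩).symm.trans_le (h ⟨v, hv⟩)
    · rw [filter_false_of_mem fun A _ hA => hv (by
        obtain ⟨u, -, rfl⟩ := mem_vertexSet.1 hA
        exact u.2)]
      exact Nat.zero_le _
  · exact fun h v => (key v).trans_le (h v)

/-- The graph induced by a set of vertices that covers all sets of the family is equivalent to
`G`. -/
theorem packing_iff_of_covered {𝓗 : GraphFamily} {r t k n' : ℕ} {ind : Bool} {distinct : Prop}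
    (hr : 1 ≤ r) (ht : 1 ≤ t) (h𝓗 : ∀ H ∈ 𝓗.toList, H.1 ≤ r) {W : Finset ℕ}
    {G' : SimpleGraph (Fin n')} (f : G' ↪g G) (hf : ∀ v : Fin n, v.val ∈ W → v ∈ Set.range f)
    (hW : ∀ S, (initFrame G k (r * k)).Fam ind 𝓗.toList S →
      Covered ((initFrame G k (r * k)).Fam ind 𝓗.toList) (r * k) W S) :
    Packing 𝓗 t ind distinct G k ↔ Packing 𝓗 t ind distinct G' k := by
  classical
  rw [packing_iff_of_embedding f]
  constructor
  · rintro ⟨K, hk, hgood, hdist, hmem⟩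
    -- Surplus members are dropped, since the flowers are large enough only for a packing of exactly
    -- `k` members.
    obtain ⟨K₁, hK₁, hk₁⟩ := exists_subset_card_eq hk
    obtain ⟨K', hk', hgood', hdist', hmem'⟩ := exists_packing_subset vertexSet
      (fun A : G.Subgraph => (ind = true → A.IsInduced) ∧ IsFamilySubgraph 𝓗 A) distinct hr ht
      (fun A hA => ((fam_initFrame_iff 𝓗 ind k (r * k) _).2 ⟨A, hA, rfl⟩).card_le h𝓗)
      (fam_initFrame_iff 𝓗 ind k (r * k)) hW K₁ hk₁ (fun A hA => hgood A (hK₁ hA))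
      (fun hd A hA B hB hAB => vertexSet_eq_iff.not.2 (hdist hd A (hK₁ hA) B (hK₁ hB) hAB))
      (fun v => (card_le_card (filter_subset_filter _ hK₁)).trans (boundedMembership_iff.1 hmem v))
    exact ⟨K', hk'.ge, fun A hA => ⟨(hgood' A hA).1, fun v hv =>
      hf v ((hgood' A hA).2 (val_mem_vertexSet.2 hv))⟩, fun hd A hA B hB hAB =>
        vertexSet_eq_iff.not.1 (hdist' hd A hA B hB hAB), boundedMembership_iff.2 hmem'⟩
  · rintro ⟨K, hk, hgood, h⟩
    exact ⟨K, hk, fun A hA => (hgood A hA).1, h⟩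

end Fin

/-- The elements of `W` below its `i`-th one are those with smaller index. Thus the ranks used by
the output agree with the increasing numbering of the kernel's vertices. -/
theorem indexIn_orderEmbOfFin (W : Finset ℕ) (i : Fin #W) :
    indexIn W (W.orderEmbOfFin rfl i) = i := by
  have : W.filter (· < W.orderEmbOfFin rfl i) = (Iio i).map (W.orderEmbOfFin rfl).toEmbedding := by
    ext v
    simp only [mem_filter, mem_map, mem_Iio, RelEmbedding.coe_toEmbedding]
    constructor
    · rintro ⟨hv, hlt⟩
      rw [← mem_coe, ← range_orderEmbOfFin W rfl] at hv
      obtain ⟨j, rfl⟩ := hv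
      exact ⟨j, (W.orderEmbOfFin rfl).lt_iff_lt.1 hlt, rfl⟩
    · rintro ⟨j, hj, rfl⟩
      exact ⟨orderEmbOfFin_mem _ _ _, (W.orderEmbOfFin rfl).lt_iff_lt.2 hj⟩
  rw [indexIn, this, card_map, Fin.card_Iio]

/-- The whole program. -/
theorem hoare_kernel {J r : ℕ} (hr : 1 ≤ r) (hJ : r + 2 ≤ J) (ind : Bool)
    {l : List (Σ m : ℕ, SimpleGraph (Fin m))} (hl : ∀ H ∈ l, H.1 ≤ r) :
    Hoare Frame.n (fun g s => g.Start s ∧ g.q = r * g.k ∧ g.W = ∅)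
      (.seq (initProg J r) (.seq (markProg J ind l r 0) (outputProg J)))
      (fun g s => ∃ W, W ⊆ range g.n ∧ #W ≤ #g.W + markBound g.q r ∧
        (∀ S, g.Fam ind l S → Covered (g.Fam ind l) g.q W S) ∧ s.v .n = #W ∧ s.v .k = g.k ∧
        ∀ u ∈ W, ∀ v ∈ W, s.m (indexIn W u * #W + indexIn W v) = g.A u v) := by
  refine (hoare_init (by omega)).seq (.seq (hoare_mark hJ ind hl r 0 (by omega))
    ((hoare_output J).conseq ?_))
  rintro g s ⟨W, -, hWn, h, hcard, hcov⟩
  exact ⟨(g, W), rfl, ⟨h, hWn⟩, fun s' hs' => ⟨W, hWn, hcard,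
    fun S hS => hcov S hS (by simp [Frame.core]), hs'⟩⟩

theorem Polynomial.eval_nat_mono (p : Polynomial ℕ) {a b : ℕ} (h : a ≤ b) :
    p.eval a ≤ p.eval b := by
  rw [Polynomial.eval_eq_sum, Polynomial.eval_eq_sum]
  exact Finset.sum_le_sum fun i _ => Nat.mul_le_mul_left _ (Nat.pow_le_pow_left h i)

/-- For `k ≥ 1` the point is `r * k + 1 ≤ (r + 1) * k`, and the factor 2 is slack. For `k = 0` there
are no petals and nothing is marked. -/
theorem markBound_le {r k : ℕ} (hr : 1 ≤ r) :
    markBound (r * k) r ≤ 2 * r.factorial * ((r + 1) ^ r * k ^ r) := by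
  rcases Nat.eq_zero_or_pos k with rfl | hk
  · obtain ⟨d, rfl⟩ := Nat.exists_eq_succ_of_ne_zero (by omega : r ≠ 0)
    simp [markBound]
  · refine (markBound_lt (r * k) r).le.trans ?_
    rw [← Nat.mul_pow]
    refine Nat.mul_le_mul (by omega) (Nat.pow_le_pow_left ?_ r)
    rw [Nat.succ_mul]
    omega

theorem hasKernel_packing (𝓗 : GraphFamily) {r t : ℕ} (hr : 𝓗.order = r) (hr1 : 1 ≤ r)
    (ht : 1 ≤ t) (ind : Bool) (distinct : Prop) :
    HasKernel (fun _ G k => Packing 𝓗 t ind distinct G k)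
      (fun k => 2 * r.factorial * ((r + 1) ^ r * k ^ r)) := by
  have hl : ∀ H ∈ 𝓗.toList, H.1 ≤ r := fun H hH =>
    hr ▸ Finset.le_sup (f := fun H : Σ m : ℕ, SimpleGraph (Fin m) => H.1) (mem_toList.1 hH)
  obtain ⟨p, hp⟩ := hoare_kernel hr1 le_rfl ind hl
  refine ⟨.seq (initProg (r + 2) r) (.seq (markProg (r + 2) ind 𝓗.toList r 0)
    (outputProg (r + 2))), p, fun n G k s hs => ?_⟩
  obtain ⟨⟨hn, hk, hG⟩, hreg, hmem⟩ := hs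
  have hstart : (initFrame G k (r * k)).Start s.env := by
    refine ⟨hn, hk, fun z hz hz' => hreg _ ?_, fun u hu v hv => ?_, hmem⟩
    · have h0 : z.code ≠ 0 := fun h => hz (Var.code_injective h)
      have h1 : z.code ≠ 1 := fun h => hz' (Var.code_injective h)
      simp only [Var.reg]; omega
    · classical
      have := hG ⟨u, hu⟩ ⟨v, hv⟩
      refine Eq.trans ?_ (adjMatrixNat_eq (G := G) ⟨u, hu⟩ ⟨v, hv⟩).symm
      split_ifs with h
      · exact this.1 h
      · exact this.2 h
  obtain ⟨T, s', he, hT, W, hWn, hcard, hcov, hn', hk', hA⟩ := hp _ s ⟨hstart, rfl, rfl⟩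
  have hWlt : ∀ i, W.orderEmbOfFin rfl i < n := fun i =>
    mem_range.1 (hWn (orderEmbOfFin_mem W rfl i))
  let f : Fin #W ↪ Fin n := ⟨fun i => ⟨W.orderEmbOfFin rfl i, hWlt i⟩, fun i j hij =>
    (W.orderEmbOfFin rfl).injective (congrArg Fin.val hij)⟩
  refine ⟨T, s', he, hT.trans (p.eval_nat_mono ?_), #W, G.comap f, k, ⟨hn', hk', fun i j => ?_⟩,
    ?_, le_rfl, ?_⟩
  -- The running time is polynomial in `n` alone, and `n` is at most the size of the instance.
  · change n ≤ n * n + Nat.size k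
    exact (Nat.le_mul_self n).trans (Nat.le_add_right _ _)
  · classical
    have h := hA _ (orderEmbOfFin_mem W rfl i) _ (orderEmbOfFin_mem W rfl j)
    rw [indexIn_orderEmbOfFin, indexIn_orderEmbOfFin] at h
    have h' : s'.mem (i * #W + j) = if G.Adj (f i) (f j) then 1 else 0 :=
      h.trans (adjMatrixNat_eq (f i) (f j))
    exact ⟨fun hij => h'.trans (if_pos hij), fun hij => h'.trans (if_neg hij)⟩
  · refine hcard.trans ?_
    rw [show (initFrame G k (r * k)).W = ∅ from rfl, card_empty, Nat.zero_add]
    exact markBound_le hr1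
  · refine packing_iff_of_covered hr1 ht hl (SimpleGraph.Embedding.comap f G) (fun v hv => ?_) hcov
    rw [← mem_coe, ← range_orderEmbOfFin W rfl] at hv
    obtain ⟨i, hi⟩ := hv
    exact ⟨i, Fin.ext hi⟩

theorem mainTheorem5 (𝓗 : GraphFamily) (r t : ℕ) (hr : 𝓗.order = r) (hr1 : 1 ≤ r) (ht : 1 ≤ t) :
    HasKernel (fun _ G k => HPackingMembership 𝓗 t G k)
        (fun k => 2 * r.factorial * ((r + 1) ^ r * k ^ r)) ∧
      HasKernel (fun _ G k => InducedHPackingMembership 𝓗 t G k)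
        (fun k => 2 * r.factorial * ((r + 1) ^ r * k ^ r)) ∧
      HasKernel (fun _ G k => HPackingMembershipISV 𝓗 t G k)
        (fun k => 2 * r.factorial * ((r + 1) ^ r * k ^ r)) := by
  -- The Boolean switches inducedness on or off; the proposition `False` makes the condition on
  -- vertex sets vacuous, which gives the ISV variant.
  have h₁ := hasKernel_packing 𝓗 hr hr1 ht false True
  have h₂ := hasKernel_packing 𝓗 hr hr1 ht true True
  have h₃ := hasKernel_packing 𝓗 hr hr1 ht false False
  simp only [Packing, true_implies, Bool.false_eq_true, false_implies, true_and] at h₁ h₂ h₃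
  exact ⟨h₁, h₂, h₃⟩
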